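/- Let $\mathfrak g$ be the Kac-Moody algebra over $\mathbb C$ of a generalized Cartan matrix, with Cartan subalgebra $\mathfrak h$ and triangular decomposition $\mathfrak g=N^-\oplus\mathfrak h\oplus N^+$. Put $\mathfrak g'=[\mathfrak g,\mathfrak g]$, $\mathfrak h'=\mathfrak h\cap\mathfrak g'$, and write $\mathfrak h=\mathfrak h'\oplus\mathfrak h''$. Let $A=\mathbb C[t_1^{\pm1},\dots,t_n^{\pm1}]$, $\mathfrak g_A=\mathfrak g'\otimes A\oplus\mathfrak h''$, $\mathfrak h_A=\mathfrak h'\otimes A\oplus\mathfrak h''$ and $\widetilde{\mathfrak g}_A=\mathfrak g_A\oplus D$, where $D$ is the abelian Lie algebra with basis $d_1,\dots,d_n$, acting by $[d_i,X\otimes t^m]=m_iX\otimes t^m$ and $[d_i,\mathfrak h'']=0$. Let $\psi:\mathfrak h_A\to\mathbb C$ be linear, and let $V(\psi)$ be the irreducible quotient of the $\mathfrak g_A$-module induced from the one-dimensional module of $(N^+\otimes A)\oplus\mathfrak h_A$ on which $N^+\otimes A$ acts by $0$ and $\mathfrak h_A$ acts by $\psi$. Let $\widetilde{\mathfrak g}_A$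 act on $V(\psi)\otimes A$ by $$(X\otimes t^m)(w\otimes t^k)=\big((X\otimes t^m)w\big)\otimes t^{m+k},\qquad h(w\otimes t^k)=(hw)\otimes t^k,\qquad d_i(w\otimes t^k)=k_i\,(w\otimes t^k)$$ for $X\in\mathfrak g'$, $h\in\mathfrak h''$, $w\in V(\psi)$, $m,k\in\mathbb Z^n$. Let $A_\psi\subseteq A$ be the subalgebra generated by the elements $\psi(h\otimes t^m)\,t^m$ with $h\in\mathfrak h'$, $m\in\mathbb Z^n$, and assume that $A_\psi=\mathbb C[t_1^{\pm r_1},\dots,t_n^{\pm r_n}]$ for positive integers $r_1,\dots,r_n$. Put $R=r_1\cdots r_n$, $\overline\Gamma=\bigoplus_{i}\mathbb Z/r_i\mathbb Z$, and let $\xi_i$ be a primitive $r_i$-th root of unity. Let $\sigma_i$ be the automorphism of $V(\psi)$ induced by the automorphism of $\mathfrak g_A$ that sends $X\otimes t^m$ to $\xi_i^{m_i}X\otimes t^m$ and is the identity on $\mathfrak h''$. That is, $\sigma_i$ fixes the image of the generator $1$ of the induced module, and $\sigma_i((X\otimes t^m)w)=\xi_i^{m_i}(X\otimes t^m)\sigma_i(w)$.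 Define $$\widetilde\eta_i(w\otimes p(t))=\sigma_i(w)\otimes p(t_1,\dots,\xi_i^{-1}t_i,\dots,t_n)\qquad(w\in V(\psi),\ p\in A),$$ and for $k=(k_1,\dots,k_n)\in\overline\Gamma$ put $$(V(\psi)\otimes A)_k=\{w\in V(\psi)\otimes A\mid \widetilde\eta_i w=\xi_i^{-k_i}w,\ 1\le i\le n\}.$$ Let $v$ be a highest weight vector of $V(\psi)$, i.e. $v\neq0$, $(N^+\otimes A)v=0$ and $hv=\psi(h)v$ for all $h\in\mathfrak h_A$. Then for every $k\in\overline\Gamma$, and every representative of $k$ in $\mathbb Z^n$ (again denoted $k$), the $\widetilde{\mathfrak g}_A$-submodule of $V(\psi)\otimes A$ generated by $v\otimes t^k$ is the joint eigenspace: $$U(\widetilde{\mathfrak g}_A)(v\otimes t^k)=(V(\psi)\otimes A)_k .$$ Moreover each $(V(\psi)\otimes A)_k$ is an irreducible $\widetilde{\mathfrak g}_A$-module and $V(\psi)\otimes A=\bigoplus_{k\in\overline\Gamma}(V(\psi)\otimes A)_k$, so these are the $R$ irreducible components of $V(\psi)\otimes A$. -/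

import Mathlib

open scoped TensorProduct

noncomputable section

namespace LoopKM

/-! ### Kac-Moody algebras -/

/-- Generalized Cartan matrices. -/
structure IsGCM {ι : Type*} (C : Matrix ι ι ℤ) : Prop where
  diag : ∀ i, C i i = 2
  nonpos : ∀ i j, i ≠ j → C i j ≤ 0
  zero_symm : ∀ i j, C i j = 0 → C j i = 0

/-- A realization `(𝔥, Π, Π^∨)` of `C`: linearly independent simple roots and simple coroots
with `⟨α_i^∨, α_j⟩ = C i j`, where `dim 𝔥 = 2 |ι| - rank C`. -/
structure Realization {ι : Type*} [Fintype ι] (C : Matrix ι ι ℤ)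
    (𝔥 : Type*) [AddCommGroup 𝔥] [Module ℂ 𝔥] where
  finite : FiniteDimensional ℂ 𝔥
  root : ι → Module.Dual ℂ 𝔥
  coroot : ι → 𝔥
  root_indep : LinearIndependent ℂ root
  coroot_indep : LinearIndependent ℂ coroot
  pairing : ∀ i j, root j (coroot i) = (C i j : ℂ)
  finrank_add_rank :
    Module.finrank ℂ 𝔥 + (C.map (Int.cast : ℤ → ℂ)).rank = 2 * Fintype.card ι

/-- Generators `e_i`, `f_i` and the elements of `𝔥`. -/
inductive Gen (ι : Type*) (𝔥 : Type*)
  | e : ι → Gen ι 𝔥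
  | f : ι → Gen ι 𝔥
  | h : 𝔥 → Gen ι 𝔥

section KacMoody

variable {ι : Type*} [Fintype ι] [DecidableEq ι] {C : Matrix ι ι ℤ}
  {𝔥 : Type*} [AddCommGroup 𝔥] [Module ℂ 𝔥] (ρ : Realization C 𝔥)

local notation "E" => fun i => FreeLieAlgebra.of ℂ (Gen.e (ι := ι) (𝔥 := 𝔥) i)
local notation "F" => fun i => FreeLieAlgebra.of ℂ (Gen.f (ι := ι) (𝔥 := 𝔥) i)
local notation "Hh" => fun x => FreeLieAlgebra.of ℂ (Gen.h (ι := ι) (𝔥 := 𝔥) x)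

/-- The defining relations of the auxiliary algebra `𝔤̃(C)`: the last two say that `𝔥` enters as a
vector space. An element of this set is declared to be zero. -/
inductive Rels : FreeLieAlgebra ℂ (Gen ι 𝔥) → Prop
  | ef (i j : ι) : Rels (⁅E i, F j⁆ - if i = j then Hh (ρ.coroot i) else 0)
  | hh (x y : 𝔥) : Rels ⁅Hh x, Hh y⁆
  | he (x : 𝔥) (i : ι) : Rels (⁅Hh x, E i⁆ - ρ.root i x • E i)
  | hf (x : 𝔥) (i : ι) : Rels (⁅Hh x, F i⁆ + ρ.root i x • F i)
  | add (x y : 𝔥) : Rels (Hh (x + y) - (Hh x + Hh y))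
  | smul (c : ℂ) (x : 𝔥) : Rels (Hh (c • x) - c • Hh x)

/-- The auxiliary Lie algebra `𝔤̃(C)`. -/
def PreKM : Type _ :=
  FreeLieAlgebra ℂ (Gen ι 𝔥) ⧸
    (LieSubmodule.lieSpan ℂ (FreeLieAlgebra ℂ (Gen ι 𝔥)) {x | Rels ρ x} :
      LieIdeal ℂ (FreeLieAlgebra ℂ (Gen ι 𝔥)))
deriving LieRing, LieAlgebra ℂ

def PreKM.mk (x : FreeLieAlgebra ℂ (Gen ι 𝔥)) : PreKM ρ :=
  LieSubmodule.Quotient.mk x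

/-- The image of `𝔥` in `𝔤̃(C)`. -/
def PreKM.cartan : Submodule ℂ (PreKM ρ) :=
  Submodule.span ℂ (Set.range fun x : 𝔥 => PreKM.mk ρ (Hh x))

/-- The maximal ideal of `𝔤̃(C)` intersecting `𝔥` trivially, i.e. the sum of all such ideals. -/
def PreKM.maxIdeal : LieIdeal ℂ (PreKM ρ) :=
  sSup {I : LieIdeal ℂ (PreKM ρ) | ∀ x ∈ I, x ∈ PreKM.cartan ρ → x = 0}

/-- The Kac-Moody algebra `𝔤(C)`. -/
def KM : Type _ := PreKM ρ ⧸ PreKM.maxIdeal ρ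
deriving LieRing, LieAlgebra ℂ

def KM.mk (x : FreeLieAlgebra ℂ (Gen ι 𝔥)) : KM ρ :=
  LieSubmodule.Quotient.mk (PreKM.mk ρ x)

/-- The Cartan subalgebra `𝔥` of `𝔤(C)`. -/
def KM.cartan : Submodule ℂ (KM ρ) :=
  Submodule.span ℂ (Set.range fun x : 𝔥 => KM.mk ρ (Hh x))

/-- The subalgebra `N⁺` generated by the `e_i`. -/
def KM.pos : Submodule ℂ (KM ρ) :=
  (LieSubalgebra.lieSpan ℂ (KM ρ) (Set.range fun i : ι => KM.mk ρ (E i))).toSubmodule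

end KacMoody

/-! ### Laurent polynomials -/

/-- `A = ℂ[t_1^{±1}, …, t_n^{±1}]`. -/
def Laurent (n : ℕ) : Type := AddMonoidAlgebra ℂ (Fin n → ℤ)
deriving CommRing, Algebra ℂ

/-- The monomials, as a basis of `A`. -/
def monoBasis (n : ℕ) : Module.Basis (Fin n → ℤ) ℂ (Laurent n) :=
  AddMonoidAlgebra.basis (Fin n → ℤ) ℂ

/-- The monomial `t^m`. -/
def mono {n : ℕ} (m : Fin n → ℤ) : Laurent n :=
  (AddMonoidAlgebra.single m 1 : AddMonoidAlgebra ℂ (Fin n → ℤ))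

lemma mono_mul {n : ℕ} (k m : Fin n → ℤ) : mono k * mono m = mono (k + m) :=
  (AddMonoidAlgebra.single_mul_single k m (1 : ℂ) 1).trans (by rw [mul_one]; rfl)

lemma mono_zero {n : ℕ} : mono (0 : Fin n → ℤ) = 1 := rfl

/-- The projection of `A` onto the line spanned by `t^m`. -/
def monoProj {n : ℕ} (m : Fin n → ℤ) : Laurent n →ₗ[ℂ] Laurent n :=
  (monoBasis n).constr ℂ fun k => if k = m then mono m else 0

/-- The derivation `∑ d_i t_i ∂/∂t_i` of `A`. -/
def degDer {n : ℕ} (d : Fin n → ℂ) : Laurent n →ₗ[ℂ] Laurent n :=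
  (monoBasis n).constr ℂ fun k => (∑ i, d i * (k i : ℂ)) • mono k

/-- The character `m ↦ c^m = ∏ c_i ^ m_i`. -/
def charPow {n : ℕ} (c : Fin n → ℂˣ) (m : Fin n → ℤ) : ℂ := ((∏ i, c i ^ m i : ℂˣ) : ℂ)

/-- The algebra endomorphism `p(t) ↦ p(c_1 t_1, …, c_n t_n)` of `A`. -/
def rescale {n : ℕ} (c : Fin n → ℂˣ) : Laurent n →ₐ[ℂ] Laurent n :=
  (AddMonoidAlgebra.lift ℂ (Laurent n) (Fin n → ℤ)
    { toFun := fun m => charPow c m.toAdd • mono m.toAdd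
      map_one' := by simp [charPow, mono_zero]
      map_mul' := fun x y => by
        simp only [charPow, toAdd_mul, Pi.add_apply, zpow_add, Finset.prod_mul_distrib,
          Units.val_mul, smul_mul_smul_comm, mono_mul] } :
    AddMonoidAlgebra ℂ (Fin n → ℤ) →ₐ[ℂ] Laurent n)

/-- The subalgebra `ℂ[t_1^{±r_1}, …, t_n^{±r_n}]` of `A`. -/
def powSubalgebra {n : ℕ} (r : Fin n → ℕ) : Subalgebra ℂ (Laurent n) :=
  Algebra.adjoin ℂ (Set.range (fun i => mono (Pi.single i (r i : ℤ))) ∪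
    Set.range fun i => mono (Pi.single i (-(r i : ℤ))))

section Facts

variable {n : ℕ}

lemma monoBasis_apply (k : Fin n → ℤ) : monoBasis n k = mono k := rfl

lemma monoProj_mono (m k : Fin n → ℤ) : monoProj m (mono k) = if k = m then mono m else 0 := by
  rw [← monoBasis_apply, monoProj, Module.Basis.constr_basis]

lemma degDer_mono (d : Fin n → ℂ) (k : Fin n → ℤ) :
    degDer d (mono k) = (∑ i, d i * (k i : ℂ)) • mono k := by
  rw [← monoBasis_apply, degDer, Module.Basis.constr_basis, monoBasis_apply]

lemma rescale_mono (c : Fin n → ℂˣ) (k : Fin n → ℤ) :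
    rescale c (mono k) = charPow c k • mono k :=
  (AddMonoidAlgebra.lift_single (R := ℂ) (A := Laurent n) _ k 1).trans (one_smul _ _)

lemma charPow_zero (c : Fin n → ℂˣ) : charPow c 0 = 1 := by simp [charPow]

lemma charPow_inv_mul (c : Fin n → ℂˣ) (k : Fin n → ℤ) : charPow c⁻¹ k * charPow c k = 1 := by
  rw [charPow, charPow, ← Units.val_mul, ← Finset.prod_mul_distrib]
  simp

lemma mono_induction {P : Laurent n → Prop} (h0 : P 0) (hadd : ∀ p q, P p → P q → P (p + q))
    (hmono : ∀ (a : ℂ) k, P (a • mono k)) (p : Laurent n) : P p := by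
  rw [← (monoBasis n).linearCombination_repr p]
  induction (monoBasis n).repr p using Finsupp.induction_linear with
  | zero => simpa using h0
  | add p q hp hq => simpa using hadd _ _ hp hq
  | single m a => simpa [monoBasis_apply] using hmono a m

lemma linearMap_ext_mono {W : Type*} [AddCommGroup W] [Module ℂ W] {f g : Laurent n →ₗ[ℂ] W}
    (h : ∀ k, f (mono k) = g (mono k)) : f = g := by
  refine LinearMap.ext fun p => ?_
  induction p using mono_induction with
  | h0 => simp
  | hadd p q hp hq => simp [hp, hq]
  | hmono a k => simp [h]

lemma degDer_mul (d : Fin n → ℂ) (p q : Laurent n) :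
    degDer d (p * q) = p * degDer d q + degDer d p * q := by
  induction p using mono_induction with
  | h0 => simp
  | hadd p p' hp hp' => simp only [add_mul, map_add, hp, hp']; abel
  | hmono a k =>
    induction q using mono_induction with
    | h0 => simp
    | hadd p p' hp hp' => simp only [mul_add, map_add, hp, hp']; abel
    | hmono b l =>
      simp only [mono_mul, map_smul, degDer_mono, smul_smul, ← add_smul,
        Pi.add_apply, Int.cast_add, mul_add, Finset.sum_add_distrib, mul_smul_comm, smul_mul_assoc]
      congr 1; ring

lemma degDer_comm (d d' : Fin n → ℂ) (p : Laurent n) :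
    degDer d (degDer d' p) = degDer d' (degDer d p) := by
  induction p using mono_induction with
  | h0 => simp
  | hadd p q hp hq => simp [hp, hq]
  | hmono a k => simp only [map_smul, degDer_mono, smul_smul]; congr 1; ring

lemma degDer_comp_comm (d d' : Fin n → ℂ) : degDer d ∘ₗ degDer d' = degDer d' ∘ₗ degDer d :=
  linearMap_ext_mono fun k => degDer_comm d d' (mono k)

lemma degDer_add (d d' : Fin n → ℂ) : degDer (d + d') = degDer d + degDer d' :=
  linearMap_ext_mono fun k => by
    simp [degDer_mono, add_mul, Finset.sum_add_distrib, add_smul]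

lemma degDer_smul (a : ℂ) (d : Fin n → ℂ) : degDer (a • d) = a • degDer d :=
  linearMap_ext_mono fun k => by
    simp [degDer_mono, mul_assoc, ← Finset.mul_sum, smul_smul]

lemma rescale_inv_rescale (c : Fin n → ℂˣ) (p : Laurent n) : rescale c⁻¹ (rescale c p) = p := by
  induction p using mono_induction with
  | h0 => simp
  | hadd p q hp hq => simp [hp, hq]
  | hmono a k =>
    simp only [map_smul, rescale_mono, smul_smul]
    rw [mul_assoc, mul_comm (charPow c k), charPow_inv_mul, mul_one]

end Facts

/-! ### Loop algebras -/

section Loop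

variable {𝔤 : Type*} [LieRing 𝔤] [LieAlgebra ℂ 𝔤]

lemma loop_lie_tmul {n : ℕ} (p q : Laurent n) (x y : 𝔤) :
    ⁅p ⊗ₜ[ℂ] x, q ⊗ₜ[ℂ] y⁆ = (p * q) ⊗ₜ[ℂ] ⁅x, y⁆ := rfl

/-- The derived algebra `𝔤' = [𝔤, 𝔤]`. -/
def derived (𝔤 : Type*) [LieRing 𝔤] [LieAlgebra ℂ 𝔤] : LieIdeal ℂ 𝔤 :=
  ⁅(⊤ : LieIdeal ℂ 𝔤), (⊤ : LieIdeal ℂ 𝔤)⁆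

/-- `S ⊗ A`, inside `𝔤 ⊗ A` (the tensor factors are written in the order `A ⊗ 𝔤`). -/
def loopSub (n : ℕ) (S : Submodule ℂ 𝔤) : Submodule ℂ (Laurent n ⊗[ℂ] 𝔤) :=
  Submodule.span ℂ {y | ∃ p : Laurent n, ∃ x ∈ S, y = p ⊗ₜ[ℂ] x}

/-- `S ⊗ 1`, inside `𝔤 ⊗ A`. -/
def constSub (n : ℕ) (S : Submodule ℂ 𝔤) : Submodule ℂ (Laurent n ⊗[ℂ] 𝔤) :=
  S.map (TensorProduct.mk ℂ (Laurent n) 𝔤 1)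

lemma tmul_mem_loopSub {n : ℕ} {S : Submodule ℂ 𝔤} (p : Laurent n) {x : 𝔤} (hx : x ∈ S) :
    p ⊗ₜ[ℂ] x ∈ loopSub n S := Submodule.subset_span ⟨p, x, hx, rfl⟩

lemma lie_mem_loopSub_derived {n : ℕ} (x y : Laurent n ⊗[ℂ] 𝔤) :
    ⁅x, y⁆ ∈ loopSub n (derived 𝔤).toSubmodule := by
  induction x using TensorProduct.induction_on with
  | zero => simp
  | add a b ha hb => rw [add_lie]; exact add_mem ha hb
  | tmul p a =>
    induction y using TensorProduct.induction_on with
    | zero => simp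
    | add c d hc hd => rw [lie_add]; exact add_mem hc hd
    | tmul q b =>
      rw [loop_lie_tmul]
      exact tmul_mem_loopSub _ (LieSubmodule.lie_mem_lie (LieSubmodule.mem_top a)
        (LieSubmodule.mem_top b))

variable (H : Submodule ℂ 𝔤) (n : ℕ)

/-- The loop algebra `𝔤_A = 𝔤' ⊗ A + 𝔥 ⊗ 1 = 𝔤' ⊗ A ⊕ 𝔥''` (for any complement `𝔥''` of
`𝔥' = 𝔥 ∩ 𝔤'` in `𝔥`), a Lie subalgebra of `𝔤 ⊗ A`. -/
def loopAlg : LieSubalgebra ℂ (Laurent n ⊗[ℂ] 𝔤) :=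
  { loopSub n (derived 𝔤).toSubmodule ⊔ constSub n H with
    lie_mem' := fun {x y} _ _ => Submodule.mem_sup_left (lie_mem_loopSub_derived x y) }

/-- `𝔥_A = 𝔥' ⊗ A + 𝔥 ⊗ 1 = 𝔥' ⊗ A ⊕ 𝔥''`. -/
def cartanLoop : Submodule ℂ (loopAlg H n) :=
  (loopSub n (H ⊓ (derived 𝔤).toSubmodule) ⊔ constSub n H).comap
    (loopAlg H n).toSubmodule.subtype

/-- `N ⊗ A`, for a subspace `N` of `𝔤'`. -/
def posLoop (N : Submodule ℂ 𝔤) : Submodule ℂ (loopAlg H n) :=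
  (loopSub n N).comap (loopAlg H n).toSubmodule.subtype

variable {H n}

lemma mem_loopAlg {x : Laurent n ⊗[ℂ] 𝔤} :
    x ∈ loopAlg H n ↔ x ∈ loopSub n (derived 𝔤).toSubmodule ⊔ constSub n H := Iff.rfl

/-- An endomorphism `f ⊗ id` of `𝔤 ⊗ A` preserves `S ⊗ A + 𝔥 ⊗ 1` as soon as `f(1) ∈ ℂ`. -/
lemma rTensor_mem {f : Laurent n →ₗ[ℂ] Laurent n} (hf : ∃ a : ℂ, f 1 = a • 1)
    {S : Submodule ℂ 𝔤} {x : Laurent n ⊗[ℂ] 𝔤} (hx : x ∈ loopSub n S ⊔ constSub n H) :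
    f.rTensor 𝔤 x ∈ loopSub n S ⊔ constSub n H := by
  have : loopSub n S ⊔ constSub n H ≤ (loopSub n S ⊔ constSub n H).comap (f.rTensor 𝔤) := by
    refine sup_le ?_ ?_
    · refine Submodule.span_le.2 ?_
      rintro _ ⟨p, x, hx, rfl⟩
      exact Submodule.mem_sup_left (by simpa using tmul_mem_loopSub (f p) hx)
    · rintro _ ⟨x, hx, rfl⟩
      obtain ⟨a, ha⟩ := hf
      refine Submodule.mem_sup_right ⟨a • x, H.smul_mem a hx, ?_⟩
      simp [ha, TensorProduct.smul_tmul]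
  exact this hx

lemma monoProj_one (m : Fin n → ℤ) : ∃ a : ℂ, monoProj m (1 : Laurent n) = a • 1 := by
  rw [← mono_zero, monoProj_mono]
  split_ifs with h
  · exact ⟨1, by rw [← h, one_smul]⟩
  · exact ⟨0, by simp⟩

lemma degDer_one (d : Fin n → ℂ) : ∃ a : ℂ, degDer d (1 : Laurent n) = a • 1 :=
  ⟨_, by rw [← mono_zero, degDer_mono]⟩

/-- The component of `x ∈ 𝔤_A` of degree `m`, i.e. the part of the form `X ⊗ t^m`. -/
def comp (m : Fin n → ℤ) : loopAlg H n →ₗ[ℂ] loopAlg H n :=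
  ((monoProj m).rTensor 𝔤).restrict (p := (loopAlg H n).toSubmodule)
    (q := (loopAlg H n).toSubmodule) fun _ hx => rTensor_mem (monoProj_one m) hx

lemma coe_comp (m : Fin n → ℤ) (x : loopAlg H n) :
    (comp m x : Laurent n ⊗[ℂ] 𝔤) = (monoProj m).rTensor 𝔤 x := rfl

/-- The derivation `∑ d_i t_i ∂/∂t_i` of `𝔤_A`. -/
def loopDer (d : Fin n → ℂ) : LieDerivation ℂ (loopAlg H n) (loopAlg H n) where
  toLinearMap := ((degDer d).rTensor 𝔤).restrict (p := (loopAlg H n).toSubmodule)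
    (q := (loopAlg H n).toSubmodule) fun _ hx => rTensor_mem (degDer_one d) hx
  leibniz' x y := by
    have key : ∀ x y : Laurent n ⊗[ℂ] 𝔤, (degDer d).rTensor 𝔤 ⁅x, y⁆ =
        ⁅x, (degDer d).rTensor 𝔤 y⁆ - ⁅y, (degDer d).rTensor 𝔤 x⁆ := by
      intro x y
      induction x using TensorProduct.induction_on with
      | zero => simp
      | add a b ha hb => simp only [add_lie, map_add, lie_add, ha, hb]; abel
      | tmul p a =>
        induction y using TensorProduct.induction_on with
        | zero => simp
        | add a b ha hb => simp only [add_lie, map_add, lie_add, ha, hb]; abel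
        | tmul q b =>
          simp only [loop_lie_tmul, LinearMap.rTensor_tmul, degDer_mul,
            TensorProduct.add_tmul]
          rw [← lie_skew a b, TensorProduct.tmul_neg, TensorProduct.tmul_neg, sub_eq_add_neg,
            mul_comm q]
    exact Subtype.ext (key x y)

lemma coe_loopDer (d : Fin n → ℂ) (x : loopAlg H n) :
    (loopDer d x : Laurent n ⊗[ℂ] 𝔤) = (degDer d).rTensor 𝔤 x := rfl

/-- The abelian Lie algebra `D` with basis `d_1, …, d_n`. -/
def Deg (n : ℕ) : Type := Fin n → ℂ
deriving AddCommGroup, Module ℂ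

/-- The coordinates with respect to `d_1, …, d_n`. -/
def Deg.coord : Deg n ≃ₗ[ℂ] (Fin n → ℂ) := LinearEquiv.refl ℂ (Fin n → ℂ)

instance : LieRing (Deg n) where
  bracket _ _ := 0
  add_lie _ _ _ := (add_zero 0).symm
  lie_add _ _ _ := (add_zero 0).symm
  lie_self _ := rfl
  leibniz_lie _ _ _ := (add_zero 0).symm

instance : LieAlgebra ℂ (Deg n) where
  lie_smul c _ _ := (smul_zero c).symm

lemma loopDer_add (d d' : Fin n → ℂ) :
    (loopDer (d + d') : LieDerivation ℂ (loopAlg H n) (loopAlg H n)) = loopDer d + loopDer d' := by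
  refine LieDerivation.ext fun x => Subtype.ext ?_
  change (degDer (d + d')).rTensor 𝔤 x.1 = (degDer d).rTensor 𝔤 x.1 + (degDer d').rTensor 𝔤 x.1
  rw [degDer_add, LinearMap.rTensor_add, LinearMap.add_apply]

lemma loopDer_smul (a : ℂ) (d : Fin n → ℂ) :
    (loopDer (a • d) : LieDerivation ℂ (loopAlg H n) (loopAlg H n)) = a • loopDer d := by
  refine LieDerivation.ext fun x => Subtype.ext ?_
  change (degDer (a • d)).rTensor 𝔤 x.1 = a • (degDer d).rTensor 𝔤 x.1
  rw [degDer_smul, LinearMap.rTensor_smul, LinearMap.smul_apply]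

lemma loopDer_lie (d d' : Fin n → ℂ) :
    ⁅loopDer (H := H) d, loopDer (H := H) d'⁆ = 0 := by
  refine LieDerivation.ext fun x => Subtype.ext ?_
  rw [LieDerivation.commutator_apply]
  change (degDer d).rTensor 𝔤 ((degDer d').rTensor 𝔤 x.1) -
    (degDer d').rTensor 𝔤 ((degDer d).rTensor 𝔤 x.1) = 0
  rw [← LinearMap.rTensor_comp_apply, ← LinearMap.rTensor_comp_apply, degDer_comp_comm d d',
    sub_self]

lemma loopDer_coord_lie (d d' : Deg n) : loopDer (H := H) (Deg.coord ⁅d, d'⁆) = 0 := by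
  have h : Deg.coord ⁅d, d'⁆ = (0 : ℂ) • (0 : Fin n → ℂ) := (smul_zero (0 : ℂ)).symm
  rw [h, loopDer_smul, zero_smul]

/-- `D` acts on `𝔤_A` by `[d_i, X ⊗ t^m] = m_i X ⊗ t^m`. -/
def degHom (H : Submodule ℂ 𝔤) (n : ℕ) :
    Deg n →ₗ⁅ℂ⁆ LieDerivation ℂ (loopAlg H n) (loopAlg H n) where
  toFun d := loopDer (Deg.coord d)
  map_add' d d' := by rw [map_add, loopDer_add]
  map_smul' a d := by rw [map_smul, loopDer_smul, RingHom.id_apply]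
  map_lie' := fun {d d'} => (loopDer_coord_lie d d').trans (loopDer_lie _ _).symm

/-- `𝔤̃_A = 𝔤_A ⊕ D`. -/
abbrev extLoopAlg (H : Submodule ℂ 𝔤) (n : ℕ) : Type _ :=
  LieAlgebra.SemiDirectSum (loopAlg H n) (Deg n) (degHom H n)

/-! ### The highest weight module `V(ψ)` -/

variable (N : Submodule ℂ 𝔤) (ψ : cartanLoop H n →ₗ[ℂ] ℂ)

attribute [local instance] LieRing.ofAssociativeRing

local notation "U" => UniversalEnvelopingAlgebra ℂ (loopAlg H n)
local notation "ιU" => UniversalEnvelopingAlgebra.ι (L := loopAlg H n) ℂ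

/-- The left ideal of `U(𝔤_A)` generated by `N ⊗ A` and the `h - ψ(h)`, `h ∈ 𝔥_A`. -/
def vermaIdeal : Submodule U U :=
  Submodule.span U ({u | ∃ x ∈ posLoop H n N, u = ιU x} ∪
    {u | ∃ h : cartanLoop H n, u = ιU h - algebraMap ℂ U (ψ h)})

/-- The module `M(ψ)` induced from the one-dimensional `(N ⊗ A) ⊕ 𝔥_A`-module defined by `ψ`,
identified with the quotient of `U(𝔤_A)` by a left ideal. -/
abbrev Verma : Type _ := U ⧸ vermaIdeal N ψ

/-- The sum of all proper submodules of `M(ψ)`. -/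
def vermaRadical : Submodule U (Verma N ψ) := sSup {S | S ≠ ⊤}

/-- `V(ψ)`, the quotient of `M(ψ)` by the sum of all proper submodules. -/
def HW : Type _ := Verma N ψ ⧸ vermaRadical N ψ
deriving AddCommGroup, Module ℂ

instance : Module U (HW N ψ) := inferInstanceAs (Module U (Verma N ψ ⧸ vermaRadical N ψ))

instance : IsScalarTower ℂ U (HW N ψ) :=
  inferInstanceAs (IsScalarTower ℂ U (Verma N ψ ⧸ vermaRadical N ψ))

/-- `V(ψ)` as a module over the Lie algebra `𝔤_A`. -/
instance : LieRingModule (loopAlg H n) (HW N ψ) where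
  bracket x v := ιU x • v
  add_lie x y v := by rw [map_add, add_smul]
  lie_add x v w := smul_add _ _ _
  leibniz_lie x y v := by
    rw [LieHom.map_lie, LieRing.of_associative_ring_bracket, sub_smul, mul_smul, mul_smul,
      sub_add_cancel]

lemma HW.lie_def (x : loopAlg H n) (v : HW N ψ) : ⁅x, v⁆ = ιU x • v := rfl

instance : LieModule ℂ (loopAlg H n) (HW N ψ) where
  smul_lie a x v := by rw [HW.lie_def, map_smul, smul_assoc, HW.lie_def]
  lie_smul a x v := by
    rw [HW.lie_def, HW.lie_def, ← algebraMap_smul U a v, ← algebraMap_smul U a (ιU x • v),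
      ← mul_smul, ← mul_smul, Algebra.commutes]

/-- Highest weight vectors of `V(ψ)`. -/
structure IsHighestWeightVector (v : HW N ψ) : Prop where
  ne_zero : v ≠ 0
  pos : ∀ x ∈ posLoop H n N, ⁅x, v⁆ = 0
  cartan : ∀ h : cartanLoop H n, ⁅(h : loopAlg H n), v⁆ = ψ h • v

/-- `h ⊗ t^m ∈ 𝔥_A` for `h ∈ 𝔥'`. -/
def cartanMono (h : ↥(H ⊓ (derived 𝔤).toSubmodule)) (m : Fin n → ℤ) : cartanLoop H n :=
  ⟨⟨mono m ⊗ₜ[ℂ] (h : 𝔤), Submodule.mem_sup_left (tmul_mem_loopSub _ h.2.2)⟩,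
    Submodule.mem_sup_left (tmul_mem_loopSub _ h.2)⟩

/-- The algebra `A_ψ`: the image of `U(𝔥' ⊗ A)` under the algebra homomorphism that extends
`h ⊗ t^m ↦ ψ(h ⊗ t^m) t^m`, i.e. the subalgebra of `A` generated by these elements. -/
def weightAlgebra : Subalgebra ℂ (Laurent n) :=
  Algebra.adjoin ℂ {p | ∃ h m, p = ψ (cartanMono h m) • mono m}

/-! ### The automorphisms -/

/-- The endomorphism `X ⊗ t^m ↦ c^m X ⊗ t^m` of `𝔤_A`. -/
def twist (c : Fin n → ℂˣ) : loopAlg H n →ₗ⁅ℂ⁆ loopAlg H n :=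
  { (((rescale c).toLinearMap).rTensor 𝔤).restrict (p := (loopAlg H n).toSubmodule)
      (q := (loopAlg H n).toSubmodule)
      fun _ hx => rTensor_mem ⟨1, by simp⟩ hx with
    map_lie' := fun {x y} => Subtype.ext
      ((LieAlgebra.ExtendScalars.map (rescale c) (LieHom.id : 𝔤 →ₗ⁅ℂ⁆ 𝔤)).map_lie x.1 y.1) }

lemma coe_twist (c : Fin n → ℂˣ) (x : loopAlg H n) :
    (twist c x : Laurent n ⊗[ℂ] 𝔤) = ((rescale c).toLinearMap).rTensor 𝔤 x := rfl

lemma twist_mem_cartanLoop (c : Fin n → ℂˣ) {x : loopAlg H n} (hx : x ∈ cartanLoop H n) :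
    twist c x ∈ cartanLoop H n :=
  rTensor_mem (f := (rescale c).toLinearMap) ⟨1, by simp⟩ hx

lemma twist_mem_posLoop (c : Fin n → ℂˣ) {x : loopAlg H n} (hx : x ∈ posLoop H n N) :
    twist c x ∈ posLoop H n N := by
  have : loopSub n N ≤ (loopSub n N).comap (((rescale c).toLinearMap).rTensor 𝔤) := by
    refine Submodule.span_le.2 ?_
    rintro _ ⟨p, x, hx, rfl⟩
    exact tmul_mem_loopSub (rescale c p) hx
  exact this hx

lemma twist_inv_twist (c : Fin n → ℂˣ) (x : loopAlg H n) : twist c⁻¹ (twist c x) = x := by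
  refine Subtype.ext ?_
  rw [coe_twist, coe_twist, ← LinearMap.rTensor_comp_apply,
    show (rescale c⁻¹).toLinearMap ∘ₗ (rescale c).toLinearMap = LinearMap.id from
      LinearMap.ext (rescale_inv_rescale c)]
  simp

/-- `ψ(h ⊗ t^m) = ψ(c^m h ⊗ t^m)` on `𝔥_A`. -/
def TwistInvariant (c : Fin n → ℂˣ) : Prop :=
  ∀ (h : loopAlg H n) (hh : h ∈ cartanLoop H n),
    ψ ⟨twist c h, twist_mem_cartanLoop c hh⟩ = ψ ⟨h, hh⟩

variable {ψ} in
lemma TwistInvariant.inv {c : Fin n → ℂˣ} (hc : TwistInvariant ψ c) : TwistInvariant ψ c⁻¹ := by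
  intro h hh
  rw [← hc _ (twist_mem_cartanLoop c⁻¹ hh)]
  congr 2
  simpa using twist_inv_twist c⁻¹ h

/-- The automorphism of `U(𝔤_A)` extending `twist c`. -/
def twistU (c : Fin n → ℂˣ) : U →ₐ[ℂ] U :=
  UniversalEnvelopingAlgebra.lift ℂ (LieHom.comp ιU (twist c))

lemma twistU_ι (c : Fin n → ℂˣ) (x : loopAlg H n) : twistU c (ιU x) = ιU (twist c x) :=
  UniversalEnvelopingAlgebra.lift_ι_apply ℂ _ x

lemma twistU_inv_twistU (c : Fin n → ℂˣ) (u : U) : twistU c⁻¹ (twistU c u) = u := by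
  have : (twistU (H := H) c⁻¹).comp (twistU c) = AlgHom.id ℂ U := by
    refine UniversalEnvelopingAlgebra.hom_ext ℂ (LieHom.ext fun x => ?_)
    change twistU c⁻¹ (twistU c (ιU x)) = ιU x
    rw [twistU_ι, twistU_ι, twist_inv_twist]
  exact DFunLike.congr_fun this u

/-- `twistU c` as a semilinear map. -/
def twistUₛ (c : Fin n → ℂˣ) : U →ₛₗ[(twistU (H := H) c : U →+* U)] U where
  toFun := twistU c
  map_add' := map_add _
  map_smul' a u := map_mul _ a u

lemma vermaIdeal_le {c : Fin n → ℂˣ} (hc : TwistInvariant ψ c) :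
    vermaIdeal N ψ ≤ (vermaIdeal N ψ).comap (twistUₛ c) := by
  refine Submodule.span_le.2 ?_
  rintro _ (⟨x, hx, rfl⟩ | ⟨h, rfl⟩)
  · refine Submodule.subset_span (Or.inl ⟨twist c x, twist_mem_posLoop N c hx, ?_⟩)
    exact twistU_ι c x
  · refine Submodule.subset_span (Or.inr ⟨⟨twist c h, twist_mem_cartanLoop c h.2⟩, ?_⟩)
    rw [hc h h.2]
    refine (map_sub (twistUₛ c) _ _).trans ?_
    exact congrArg₂ _ (twistU_ι c _) ((twistU c).commutes _)

/-- The map induced on `M(ψ)`. -/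
def twistVerma {c : Fin n → ℂˣ} (hc : TwistInvariant ψ c) :
    Verma N ψ →ₛₗ[(twistU (H := H) c : U →+* U)] Verma N ψ :=
  Submodule.mapQ _ _ (twistUₛ c) (vermaIdeal_le N ψ hc)

lemma twistVerma_inv {c : Fin n → ℂˣ} (hc : TwistInvariant ψ c) (hc' : TwistInvariant ψ c⁻¹)
    (x : Verma N ψ) : twistVerma N ψ hc' (twistVerma N ψ hc x) = x := by
  obtain ⟨u, rfl⟩ := Submodule.Quotient.mk_surjective _ x
  exact congrArg _ (twistU_inv_twistU c u)

lemma twistVerma_inv' {c : Fin n → ℂˣ} (hc : TwistInvariant ψ c) (hc' : TwistInvariant ψ c⁻¹)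
    (x : Verma N ψ) : twistVerma N ψ hc (twistVerma N ψ hc' x) = x := by
  obtain ⟨u, rfl⟩ := Submodule.Quotient.mk_surjective _ x
  have h := twistU_inv_twistU c⁻¹ u
  rw [inv_inv] at h
  exact congrArg _ h

lemma vermaRadical_le {c : Fin n → ℂˣ} (hc : TwistInvariant ψ c) :
    vermaRadical N ψ ≤ (vermaRadical N ψ).comap (twistVerma N ψ hc) := by
  refine sSup_le fun S hS x hx => ?_
  refine (le_sSup (a := S.comap (twistVerma N ψ hc.inv)) fun htop => hS ?_ :
    S.comap (twistVerma N ψ hc.inv) ≤ vermaRadical N ψ) ?_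
  · refine eq_top_iff.2 fun y _ => ?_
    have : twistVerma N ψ hc y ∈ S.comap (twistVerma N ψ hc.inv) := htop ▸ Submodule.mem_top
    simpa [twistVerma_inv] using this
  · simpa [twistVerma_inv] using hx

/-- The map induced on `V(ψ)`, semilinear version. -/
def twistHWₛ {c : Fin n → ℂˣ} (hc : TwistInvariant ψ c) :
    HW N ψ →ₛₗ[(twistU (H := H) c : U →+* U)] HW N ψ :=
  Submodule.mapQ (vermaRadical N ψ) (vermaRadical N ψ) (twistVerma N ψ hc)
    (vermaRadical_le N ψ hc)

lemma twistHWₛ_inv {c : Fin n → ℂˣ} (hc : TwistInvariant ψ c) (hc' : TwistInvariant ψ c⁻¹)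
    (x : HW N ψ) : twistHWₛ N ψ hc' (twistHWₛ N ψ hc x) = x := by
  obtain ⟨u, rfl⟩ := Submodule.Quotient.mk_surjective _ x
  exact congrArg _ (twistVerma_inv N ψ hc hc' u)

lemma twistHWₛ_inv' {c : Fin n → ℂˣ} (hc : TwistInvariant ψ c) (hc' : TwistInvariant ψ c⁻¹)
    (x : HW N ψ) : twistHWₛ N ψ hc (twistHWₛ N ψ hc' x) = x := by
  obtain ⟨u, rfl⟩ := Submodule.Quotient.mk_surjective _ x
  exact congrArg _ (twistVerma_inv' N ψ hc hc' u)

lemma twistHWₛ_smul {c : Fin n → ℂˣ} (hc : TwistInvariant ψ c) (a : ℂ) (v : HW N ψ) :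
    twistHWₛ N ψ hc (a • v) = a • twistHWₛ N ψ hc v := by
  rw [← algebraMap_smul U a v, map_smulₛₗ, ← algebraMap_smul U a (twistHWₛ N ψ hc v)]
  congr 1
  exact (twistU c).commutes a

/-- The automorphism of `V(ψ)` induced by the automorphism `X ⊗ t^m ↦ c^m X ⊗ t^m` of `𝔤_A`:
it fixes the image of `1 ∈ U(𝔤_A)` and maps `(X ⊗ t^m) w` to `c^m (X ⊗ t^m) σ(w)`. -/
def twistHW {c : Fin n → ℂˣ} (hc : TwistInvariant ψ c) : HW N ψ ≃ₗ[ℂ] HW N ψ where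
  toFun := twistHWₛ N ψ hc
  invFun := twistHWₛ N ψ hc.inv
  map_add' := map_add _
  map_smul' := twistHWₛ_smul N ψ hc
  left_inv := twistHWₛ_inv N ψ hc hc.inv
  right_inv := twistHWₛ_inv' N ψ hc hc.inv

lemma twistHW_lie {c : Fin n → ℂˣ} (hc : TwistInvariant ψ c) (x : loopAlg H n) (v : HW N ψ) :
    twistHW N ψ hc ⁅x, v⁆ = ⁅twist c x, twistHW N ψ hc v⁆ := by
  change twistHWₛ N ψ hc (ιU x • v) = ιU (twist c x) • twistHWₛ N ψ hc v
  rw [map_smulₛₗ, ← twistU_ι]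
  rfl

/-! ### The module `V(ψ) ⊗ A` -/

lemma rTensor_monoProj (x : Laurent n ⊗[ℂ] 𝔤) (m : Fin n → ℤ) :
    ∃ X : 𝔤, (monoProj m).rTensor 𝔤 x = mono m ⊗ₜ[ℂ] X := by
  induction x using TensorProduct.induction_on with
  | zero => exact ⟨0, by simp⟩
  | add x y hx hy =>
    obtain ⟨X, hX⟩ := hx
    obtain ⟨Y, hY⟩ := hy
    exact ⟨X + Y, by rw [map_add, hX, hY, TensorProduct.tmul_add]⟩
  | tmul p X =>
    have : ∃ a : ℂ, monoProj m p = a • mono m := by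
      induction p using mono_induction with
      | h0 => exact ⟨0, by simp⟩
      | hadd p q hp hq =>
        obtain ⟨a, ha⟩ := hp
        obtain ⟨b, hb⟩ := hq
        exact ⟨a + b, by rw [map_add, ha, hb, add_smul]⟩
      | hmono a k =>
        rw [map_smul, monoProj_mono]
        split_ifs
        · exact ⟨a, rfl⟩
        · exact ⟨0, by simp⟩
    obtain ⟨a, ha⟩ := this
    exact ⟨a • X, by rw [LinearMap.rTensor_tmul, ha, TensorProduct.smul_tmul]⟩

/-- Every element is the finite sum of its homogeneous components. -/
lemma exists_finset_rTensor (x : Laurent n ⊗[ℂ] 𝔤) : ∃ s : Finset (Fin n → ℤ),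
    (∀ m ∉ s, (monoProj m).rTensor 𝔤 x = 0) ∧ ∑ m ∈ s, (monoProj m).rTensor 𝔤 x = x := by
  classical
  have base : ∀ (p : Laurent n) (X : 𝔤), ∃ s : Finset (Fin n → ℤ),
      ∀ t, s ⊆ t → (∀ m ∉ t, (monoProj m).rTensor 𝔤 (p ⊗ₜ[ℂ] X) = 0) ∧
        ∑ m ∈ t, (monoProj m).rTensor 𝔤 (p ⊗ₜ[ℂ] X) = p ⊗ₜ[ℂ] X := by
    intro p X
    induction p using mono_induction with
    | h0 => exact ⟨∅, fun t _ => by simp⟩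
    | hadd p q hp hq =>
      obtain ⟨s, hs⟩ := hp
      obtain ⟨s', hs'⟩ := hq
      refine ⟨s ∪ s', fun t ht => ?_⟩
      have h1 := hs t (Finset.union_subset_left ht)
      have h2 := hs' t (Finset.union_subset_right ht)
      refine ⟨fun m hm => ?_, ?_⟩
      · rw [TensorProduct.add_tmul, map_add, h1.1 m hm, h2.1 m hm, add_zero]
      · simp only [TensorProduct.add_tmul, map_add, Finset.sum_add_distrib, h1.2, h2.2]
    | hmono a k =>
      refine ⟨{k}, fun t ht => ⟨fun m hm => ?_, ?_⟩⟩
      · have : k ≠ m := fun h => hm (h ▸ ht (Finset.mem_singleton_self k))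
        simp [monoProj_mono, this]
      · have hk : k ∈ t := ht (Finset.mem_singleton_self k)
        rw [Finset.sum_eq_single_of_mem k hk]
        · simp [monoProj_mono]
        · intro m _ hm
          simp [monoProj_mono, hm.symm]
  have main : ∃ s : Finset (Fin n → ℤ),
      ∀ t, s ⊆ t → (∀ m ∉ t, (monoProj m).rTensor 𝔤 x = 0) ∧
        ∑ m ∈ t, (monoProj m).rTensor 𝔤 x = x := by
    induction x using TensorProduct.induction_on with
    | zero => exact ⟨∅, fun t _ => by simp⟩
    | tmul p X => exact base p X
    | add x y hx hy =>
      obtain ⟨s, hs⟩ := hx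
      obtain ⟨s', hs'⟩ := hy
      refine ⟨s ∪ s', fun t ht => ?_⟩
      have h1 := hs t (Finset.union_subset_left ht)
      have h2 := hs' t (Finset.union_subset_right ht)
      refine ⟨fun m hm => ?_, ?_⟩
      · rw [map_add, h1.1 m hm, h2.1 m hm, add_zero]
      · simp only [map_add, Finset.sum_add_distrib, h1.2, h2.2]
  obtain ⟨s, hs⟩ := main
  exact ⟨s, hs s subset_rfl⟩

lemma exists_finset_comp (x : loopAlg H n) : ∃ s : Finset (Fin n → ℤ),
    (∀ m ∉ s, comp m x = 0) ∧ ∑ m ∈ s, comp m x = x := by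
  obtain ⟨s, h1, h2⟩ := exists_finset_rTensor (x : Laurent n ⊗[ℂ] 𝔤)
  refine ⟨s, fun m hm => Subtype.ext (h1 m hm), Subtype.ext ?_⟩
  refine Eq.trans ?_ h2
  exact map_sum (loopAlg H n).toSubmodule.subtype _ _

lemma finite_comp (x : loopAlg H n) : {m | comp m x ≠ 0}.Finite := by
  obtain ⟨s, hs, -⟩ := exists_finset_comp x
  exact s.finite_toSet.subset fun m hm => by
    by_contra h
    exact hm (hs m h)

/-- `x` is of the form `X ⊗ t^m`. -/
def IsHomog (m : Fin n → ℤ) (x : loopAlg H n) : Prop :=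
  ∃ X : 𝔤, (x : Laurent n ⊗[ℂ] 𝔤) = mono m ⊗ₜ[ℂ] X

lemma isHomog_comp (m : Fin n → ℤ) (x : loopAlg H n) : IsHomog m (comp m x) :=
  rTensor_monoProj (x : Laurent n ⊗[ℂ] 𝔤) m

lemma IsHomog.comp_eq {m : Fin n → ℤ} {x : loopAlg H n} (hx : IsHomog m x) (k : Fin n → ℤ) :
    comp k x = if k = m then x else 0 := by
  obtain ⟨X, hX⟩ := hx
  refine Subtype.ext ?_
  rw [coe_comp, hX, LinearMap.rTensor_tmul, monoProj_mono]
  split_ifs with h1 h2 h2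
  · rw [hX, h1]
  · exact absurd h1.symm h2
  · exact absurd h2.symm h1
  · simp

lemma IsHomog.lie {k m : Fin n → ℤ} {x y : loopAlg H n} (hx : IsHomog k x) (hy : IsHomog m y) :
    IsHomog (k + m) ⁅x, y⁆ := by
  obtain ⟨X, hX⟩ := hx
  obtain ⟨Y, hY⟩ := hy
  refine ⟨⁅X, Y⁆, ?_⟩
  rw [LieSubalgebra.coe_bracket, hX, hY, loop_lie_tmul, mono_mul]

lemma homog_induction {P : loopAlg H n → Prop} (h0 : P 0) (hadd : ∀ x y, P x → P y → P (x + y))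
    (hh : ∀ m x, IsHomog m x → P x) (x : loopAlg H n) : P x := by
  obtain ⟨s, -, hs⟩ := exists_finset_comp x
  rw [← hs]
  exact Finset.sum_induction _ P hadd h0 fun m _ => hh m _ (isHomog_comp m x)

variable {N ψ}

/-- The operator `w ⊗ p ↦ (x w) ⊗ t^m p` on `V(ψ) ⊗ A`. -/
def shiftAct (m : Fin n → ℤ) : loopAlg H n →ₗ[ℂ] Module.End ℂ (HW N ψ ⊗[ℂ] Laurent n) :=
  (TensorProduct.mapBilinear (RingHom.id ℂ) (HW N ψ) (Laurent n) (HW N ψ) (Laurent n)).flip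
    (LinearMap.mulLeft ℂ (mono m)) ∘ₗ (LieModule.toEnd ℂ (loopAlg H n) (HW N ψ)).toLinearMap

lemma shiftAct_tmul (m : Fin n → ℤ) (x : loopAlg H n) (w : HW N ψ) (p : Laurent n) :
    shiftAct m x (w ⊗ₜ[ℂ] p) = ⁅x, w⁆ ⊗ₜ[ℂ] (mono m * p) := rfl

/-- The action of `𝔤_A` on `V(ψ) ⊗ A`, summed over the homogeneous components of `x`. -/
def loopAct : loopAlg H n →ₗ[ℂ] Module.End ℂ (HW N ψ ⊗[ℂ] Laurent n) where
  toFun x := ∑ᶠ m, shiftAct m (comp m x)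
  map_add' x y := by
    simp only [map_add]
    refine finsum_add_distrib ?_ ?_
    · exact (finite_comp x).subset fun m hm h => hm (by
        change shiftAct m (comp m _) = 0
        rw [h, map_zero])
    · exact (finite_comp y).subset fun m hm h => hm (by
        change shiftAct m (comp m _) = 0
        rw [h, map_zero])
  map_smul' a x := by
    simp only [map_smul, RingHom.id_apply]
    rw [smul_finsum]

lemma IsHomog.loopAct_eq {m : Fin n → ℤ} {x : loopAlg H n} (hx : IsHomog m x) :
    loopAct (N := N) (ψ := ψ) x = shiftAct m x := by
  change ∑ᶠ k, shiftAct k (comp k x) = _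
  rw [finsum_eq_single _ m]
  · rw [hx.comp_eq, if_pos rfl]
  · intro k hk
    rw [hx.comp_eq, if_neg hk, map_zero]

/-- `(X ⊗ t^m)(w ⊗ p) = ((X ⊗ t^m) w) ⊗ t^m p`. -/
lemma IsHomog.loopAct_tmul {m : Fin n → ℤ} {x : loopAlg H n} (hx : IsHomog m x) (w : HW N ψ)
    (p : Laurent n) : loopAct x (w ⊗ₜ[ℂ] p) = ⁅x, w⁆ ⊗ₜ[ℂ] (mono m * p) := by
  rw [hx.loopAct_eq, shiftAct_tmul]

lemma loopAct_lie (x y : loopAlg H n) : loopAct (N := N) (ψ := ψ) ⁅x, y⁆ =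
    loopAct x * loopAct y - loopAct y * loopAct x := by
  induction x using homog_induction with
  | h0 => simp
  | hadd x x' hx hx' => simp only [add_lie, map_add, hx, hx', add_mul, mul_add]; abel
  | hh k x hx =>
    induction y using homog_induction with
    | h0 => simp
    | hadd x x' hx hx' => simp only [lie_add, map_add, hx, hx', add_mul, mul_add]; abel
    | hh m y hy =>
      refine TensorProduct.ext' fun w p => ?_
      rw [LinearMap.sub_apply, Module.End.mul_apply, Module.End.mul_apply,
        (hx.lie hy).loopAct_tmul, hy.loopAct_tmul, hx.loopAct_tmul, hx.loopAct_tmul,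
        hy.loopAct_tmul, ← mul_assoc, ← mul_assoc, mul_comm (mono m) (mono k), mono_mul,
        ← TensorProduct.sub_tmul, lie_lie]

/-- The action of `D` on `V(ψ) ⊗ A`: `d_i (w ⊗ t^k) = k_i (w ⊗ t^k)`. -/
def degAct : Deg n →ₗ[ℂ] Module.End ℂ (HW N ψ ⊗[ℂ] Laurent n) where
  toFun d := (degDer (Deg.coord d)).lTensor (HW N ψ)
  map_add' d d' := by rw [map_add, degDer_add, LinearMap.lTensor_add]
  map_smul' a d := by rw [map_smul, degDer_smul, LinearMap.lTensor_smul, RingHom.id_apply]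

lemma degAct_tmul (d : Deg n) (w : HW N ψ) (p : Laurent n) :
    degAct d (w ⊗ₜ[ℂ] p) = w ⊗ₜ[ℂ] degDer (Deg.coord d) p := rfl

lemma degAct_comm (d d' : Deg n) :
    degAct (N := N) (ψ := ψ) d * degAct d' = degAct d' * degAct d := by
  refine TensorProduct.ext' fun w p => ?_
  rw [Module.End.mul_apply, Module.End.mul_apply, degAct_tmul, degAct_tmul, degAct_tmul,
    degAct_tmul, degDer_comm]

lemma loopAct_degHom (d : Deg n) (x : loopAlg H n) :
    loopAct (N := N) (ψ := ψ) (degHom H n d x) = degAct d * loopAct x - loopAct x * degAct d := by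
  induction x using homog_induction with
  | h0 => simp
  | hadd x x' hx hx' => simp only [map_add, hx, hx', add_mul, mul_add]; abel
  | hh k x hx =>
    have h : degHom H n d x = (∑ i, Deg.coord d i * (k i : ℂ)) • x := by
      obtain ⟨X, hX⟩ := hx
      refine Subtype.ext ?_
      change (degDer (Deg.coord d)).rTensor 𝔤 (x : Laurent n ⊗[ℂ] 𝔤) =
        (∑ i, Deg.coord d i * (k i : ℂ)) • (x : Laurent n ⊗[ℂ] 𝔤)
      rw [hX, LinearMap.rTensor_tmul, degDer_mono, TensorProduct.smul_tmul']
    refine TensorProduct.ext' fun w p => ?_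
    rw [LinearMap.sub_apply, Module.End.mul_apply, Module.End.mul_apply, h, map_smul,
      LinearMap.smul_apply, hx.loopAct_tmul, degAct_tmul, degAct_tmul, hx.loopAct_tmul,
      degDer_mul, degDer_mono, TensorProduct.tmul_add, smul_mul_assoc, TensorProduct.tmul_smul]
    abel

/-- The action of `𝔤̃_A = 𝔤_A ⊕ D` on `V(ψ) ⊗ A`. -/
instance : LieRingModule (extLoopAlg H n) (HW N ψ ⊗[ℂ] Laurent n) where
  bracket x w := loopAct x.left w + degAct x.right w
  add_lie x y w := by
    simp only [LieAlgebra.SemiDirectSum.add_eq_mk, map_add, LinearMap.add_apply]; abel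
  lie_add x w w' := by simp only [map_add]; abel
  leibniz_lie x y w := by
    have h0 : ∀ d d' : Deg n, ⁅d, d'⁆ = 0 := fun _ _ => rfl
    have hc := LinearMap.congr_fun (degAct_comm (N := N) (ψ := ψ) (H := H) x.right y.right) w
    simp only [LieAlgebra.SemiDirectSum.lie_eq_mk, map_add, map_sub, LinearMap.add_apply,
      LinearMap.sub_apply, loopAct_lie, loopAct_degHom, h0, map_zero, LinearMap.zero_apply,
      Module.End.mul_apply] at hc ⊢
    rw [hc]
    abel

lemma ext_lie_def (x : extLoopAlg H n) (w : HW N ψ ⊗[ℂ] Laurent n) :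
    ⁅x, w⁆ = loopAct x.left w + degAct x.right w := rfl

instance : LieModule ℂ (extLoopAlg H n) (HW N ψ ⊗[ℂ] Laurent n) where
  smul_lie a x w := by
    simp only [ext_lie_def, LieAlgebra.SemiDirectSum.smul_eq_mk, map_smul, LinearMap.smul_apply,
      smul_add]
  lie_smul a x w := by simp only [ext_lie_def, map_smul, smul_add]

/-! ### The joint eigenspaces -/

lemma rescale_eq_of_mem {c : Fin n → ℂˣ} {r : Fin n → ℕ} (hc : ∀ i, c i ^ r i = 1)
    {p : Laurent n} (hp : p ∈ powSubalgebra r) : rescale c p = p := by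
  have h : ∀ (i : Fin n) (a : ℤ), c i ^ a = 1 → charPow c (Pi.single i a) = 1 := by
    intro i a ha
    rw [charPow, Finset.prod_eq_one, Units.val_one]
    intro j _
    by_cases hj : j = i
    · subst hj; rw [Pi.single_eq_same, ha]
    · rw [Pi.single_eq_of_ne hj, zpow_zero]
  have hle : powSubalgebra r ≤ AlgHom.equalizer (rescale c) (AlgHom.id ℂ (Laurent n)) := by
    refine Algebra.adjoin_le ?_
    rintro _ (⟨i, rfl⟩ | ⟨i, rfl⟩)
    · change rescale c _ = _
      rw [rescale_mono, h i _ (by rw [zpow_natCast, hc i]), one_smul, AlgHom.id_apply]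
    · change rescale c _ = _
      rw [rescale_mono, h i _ (by rw [zpow_neg, zpow_natCast, hc i, inv_one]), one_smul,
        AlgHom.id_apply]
  exact hle hp

variable (ψ) in
/-- If `A_ψ = ℂ[t_1^{±r_1}, …, t_n^{±r_n}]` and `c_i ^ r_i = 1`, then `ψ` is invariant. -/
lemma twistInvariant_of_weightAlgebra_eq {c : Fin n → ℂˣ} {r : Fin n → ℕ}
    (hψ : weightAlgebra ψ = powSubalgebra r) (hc : ∀ i, c i ^ r i = 1) : TwistInvariant ψ c := by
  have hmono : ∀ h m, ψ (cartanMono h m) * charPow c m = ψ (cartanMono h m) := by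
    intro h m
    have hmem : ψ (cartanMono h m) • (mono m : Laurent n) ∈ powSubalgebra r :=
      hψ ▸ Algebra.subset_adjoin ⟨h, m, rfl⟩
    have := rescale_eq_of_mem hc hmem
    rw [map_smul, rescale_mono, smul_smul, ← sub_eq_zero, ← sub_smul, smul_eq_zero] at this
    exact sub_eq_zero.1 (this.resolve_right ((monoBasis n).ne_zero m))
  let tw : cartanLoop H n →ₗ[ℂ] cartanLoop H n :=
    (twist (H := H) c).toLinearMap.restrict fun _ hx => twist_mem_cartanLoop c hx
  let K : Submodule ℂ (Laurent n ⊗[ℂ] 𝔤) :=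
    (LinearMap.ker (ψ ∘ₗ tw - ψ)).map
      ((loopAlg H n).toSubmodule.subtype ∘ₗ (cartanLoop H n).subtype)
  have hK : loopSub n (H ⊓ (derived 𝔤).toSubmodule) ⊔ constSub n H ≤ K := by
    refine sup_le (Submodule.span_le.2 ?_) ?_
    · rintro _ ⟨p, x, hx, rfl⟩
      induction p using mono_induction with
      | h0 => rw [TensorProduct.zero_tmul]; exact K.zero_mem
      | hadd p q hp hq => rw [TensorProduct.add_tmul]; exact K.add_mem hp hq
      | hmono a m =>
        rw [← TensorProduct.smul_tmul']
        refine K.smul_mem a ⟨cartanMono ⟨x, hx⟩ m, ?_, rfl⟩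
        have : tw (cartanMono ⟨x, hx⟩ m) = charPow c m • cartanMono ⟨x, hx⟩ m := by
          refine Subtype.ext (Subtype.ext ?_)
          change rescale c (mono m) ⊗ₜ[ℂ] x = charPow c m • (mono m ⊗ₜ[ℂ] x)
          rw [rescale_mono, TensorProduct.smul_tmul']
        rw [SetLike.mem_coe, LinearMap.mem_ker, LinearMap.sub_apply, LinearMap.comp_apply, this,
          map_smul, smul_eq_mul, mul_comm, hmono, sub_self]
    · rintro _ ⟨x, hx, rfl⟩
      have hx' : (1 : Laurent n) ⊗ₜ[ℂ] x ∈ constSub n H := ⟨x, hx, rfl⟩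
      refine ⟨⟨⟨1 ⊗ₜ[ℂ] x, Submodule.mem_sup_right hx'⟩, Submodule.mem_sup_right hx'⟩, ?_, rfl⟩
      rw [SetLike.mem_coe, LinearMap.mem_ker, LinearMap.sub_apply, LinearMap.comp_apply,
        sub_eq_zero]
      congr 1
      refine Subtype.ext (Subtype.ext ?_)
      change rescale c 1 ⊗ₜ[ℂ] x = 1 ⊗ₜ[ℂ] x
      rw [map_one]
  intro h hh
  obtain ⟨k, hk, hkh⟩ := hK hh
  have hk' : k = ⟨h, hh⟩ := Subtype.ext (Subtype.ext hkh)
  subst hk'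
  exact sub_eq_zero.1 (LinearMap.mem_ker.1 hk)

/-- The map `w ⊗ p(t) ↦ σ(w) ⊗ p(c⁻¹ t)` on `V(ψ) ⊗ A`, where `σ` is the automorphism of `V(ψ)`
induced by `X ⊗ t^m ↦ c^m X ⊗ t^m`. -/
def etaTilde {c : Fin n → ℂˣ} (hc : TwistInvariant ψ c) :
    Module.End ℂ (HW N ψ ⊗[ℂ] Laurent n) :=
  TensorProduct.map (twistHW N ψ hc).toLinearMap (rescale c⁻¹).toLinearMap

lemma etaTilde_tmul {c : Fin n → ℂˣ} (hc : TwistInvariant ψ c) (w : HW N ψ) (p : Laurent n) :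
    etaTilde hc (w ⊗ₜ[ℂ] p) = twistHW N ψ hc w ⊗ₜ[ℂ] rescale c⁻¹ p := rfl

lemma etaTilde_loopAct {c : Fin n → ℂˣ} (hc : TwistInvariant ψ c) (x : loopAlg H n) :
    etaTilde (N := N) hc * loopAct x = loopAct x * etaTilde hc := by
  induction x using homog_induction with
  | h0 => simp
  | hadd x x' hx hx' => simp only [map_add, hx, hx', add_mul, mul_add]
  | hh k x hx =>
    have h : twist c x = charPow c k • x := by
      obtain ⟨X, hX⟩ := hx
      refine Subtype.ext ?_
      rw [coe_twist, hX, LinearMap.rTensor_tmul, AlgHom.toLinearMap_apply, rescale_mono,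
        ← TensorProduct.smul_tmul', ← hX]
      rfl
    refine TensorProduct.ext' fun w p => ?_
    rw [Module.End.mul_apply, Module.End.mul_apply, hx.loopAct_tmul, etaTilde_tmul, etaTilde_tmul,
      hx.loopAct_tmul, twistHW_lie, h, smul_lie, map_mul, rescale_mono, smul_mul_assoc,
      TensorProduct.tmul_smul, TensorProduct.smul_tmul', smul_smul, charPow_inv_mul, one_smul]

lemma etaTilde_degAct {c : Fin n → ℂˣ} (hc : TwistInvariant ψ c) (d : Deg n) :
    etaTilde (N := N) hc * degAct d = degAct d * etaTilde hc := by
  refine TensorProduct.ext' fun w p => ?_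
  rw [Module.End.mul_apply, Module.End.mul_apply, degAct_tmul, etaTilde_tmul, etaTilde_tmul,
    degAct_tmul]
  congr 1
  have : (rescale c⁻¹).toLinearMap ∘ₗ degDer (Deg.coord d) =
      degDer (Deg.coord d) ∘ₗ (rescale c⁻¹).toLinearMap :=
    linearMap_ext_mono fun k => by
      simp only [LinearMap.comp_apply, AlgHom.toLinearMap_apply, degDer_mono, rescale_mono,
        map_smul]
      rw [smul_comm]
  exact LinearMap.congr_fun this p

/-- `η̃` is an automorphism of the `𝔤̃_A`-module `V(ψ) ⊗ A`. -/
lemma etaTilde_lie {c : Fin n → ℂˣ} (hc : TwistInvariant ψ c) (x : extLoopAlg H n)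
    (w : HW N ψ ⊗[ℂ] Laurent n) : etaTilde hc ⁅x, w⁆ = ⁅x, etaTilde hc w⁆ := by
  have h1 := LinearMap.congr_fun (etaTilde_loopAct (N := N) hc x.left) w
  have h2 := LinearMap.congr_fun (etaTilde_degAct (N := N) hc x.right) w
  rw [Module.End.mul_apply, Module.End.mul_apply] at h1 h2
  rw [ext_lie_def, ext_lie_def, map_add, h1, h2]

lemma mulSingle_pow {r : Fin n → ℕ} {ξ : Fin n → ℂˣ} (hξ : ∀ i, IsPrimitiveRoot (ξ i) (r i))
    (i j : Fin n) : (Pi.mulSingle i (ξ i) : Fin n → ℂˣ) j ^ r j = 1 := by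
  by_cases h : j = i
  · subst h; rw [Pi.mulSingle_eq_same, (hξ j).pow_eq_one]
  · rw [Pi.mulSingle_eq_of_ne h, one_pow]

variable (N) in
/-- The automorphism `η̃_i : w ⊗ p(t) ↦ σ_i(w) ⊗ p(t_1, …, ξ_i⁻¹ t_i, …, t_n)`, where `σ_i` is the
automorphism of `V(ψ)` induced by `t_i ↦ ξ_i t_i`. -/
def etaTildeAt {r : Fin n → ℕ} (hψ : weightAlgebra ψ = powSubalgebra r) {ξ : Fin n → ℂˣ}
    (hξ : ∀ i, IsPrimitiveRoot (ξ i) (r i)) (i : Fin n) :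
    Module.End ℂ (HW N ψ ⊗[ℂ] Laurent n) :=
  etaTilde (twistInvariant_of_weightAlgebra_eq ψ hψ (mulSingle_pow hξ i))

variable (N) in
/-- The `𝔤̃_A`-submodule `(V(ψ) ⊗ A)_k`: the joint eigenspace of the `η̃_i` with eigenvalues
`ξ_i ^ (-k_i)`. -/
def jointEigenspace {r : Fin n → ℕ} (hψ : weightAlgebra ψ = powSubalgebra r) {ξ : Fin n → ℂˣ}
    (hξ : ∀ i, IsPrimitiveRoot (ξ i) (r i)) (k : (i : Fin n) → ZMod (r i)) :
    LieSubmodule ℂ (extLoopAlg H n) (HW N ψ ⊗[ℂ] Laurent n) :=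
  { (⨅ i, (etaTildeAt N hψ hξ i).eigenspace ((ξ i ^ (-((k i).val : ℤ)) : ℂˣ) : ℂ) :
      Submodule ℂ (HW N ψ ⊗[ℂ] Laurent n)) with
    lie_mem := fun {x w} hw => by
      change w ∈ (⨅ i, _ : Submodule ℂ (HW N ψ ⊗[ℂ] Laurent n)) at hw
      change _ ∈ (⨅ i, _ : Submodule ℂ (HW N ψ ⊗[ℂ] Laurent n))
      rw [Submodule.mem_iInf] at hw ⊢
      intro i
      have := hw i
      rw [Module.End.mem_eigenspace_iff] at this ⊢
      rw [etaTildeAt, etaTilde_lie]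
      rw [etaTildeAt] at this
      rw [this, lie_smul] }

end Loop

end LoopKM

end

/-!
Choose `x ∈ 𝔥` with `α_i(x) = 1` for all simple roots. The eigenvalues of `ad x` grade `𝔤`, and
those of `x` on `V(ψ)` are `ψ(x), ψ(x) - 1, …`, with `ψ(x)` occurring only on the line of highest
weight vectors; in particular the twists `σ_i` fix every highest weight vector `v`.

A nonzero submodule `S` of `V(ψ) ⊗ A` is graded, because the `d_i` act, so for some `m` the slice
`{w | w ⊗ t^m ∈ S}` is nonzero. The sum of the slices is stable under `𝔤_A`, hence equals `V(ψ)`;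
as each slice is stable under `x`, one of them contains `v`. The elements `h ⊗ t^s` multiply the
second factor of `v ⊗ t^m` by the generators of `A_ψ`, so the submodule generated by `v ⊗ t^m`
depends only on `m` modulo the `r_i`, and these submodules span `V(ψ) ⊗ A`. They lie in the joint
eigenspaces, which are independent, and independence turns the inclusions into equalities.
-/

noncomputable section

namespace LoopKM

/-! ### Joint eigenvectors -/

section Eigen

open Module.End

variable {K M : Type*} [Field K] [AddCommGroup M] [Module K M]

lemma mem_of_add_iSup_eigenspace_mem {f : Module.End K M} {p : Submodule K M}
    (hp : p ≤ p.comap f) {a : K} {u w : M} (hu : u ∈ f.eigenspace a)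
    (hw : w ∈ ⨆ (b) (_ : b ≠ a), f.eigenspace b) (h : u + w ∈ p) : u ∈ p := by
  let fQ : Module.End K (M ⧸ p) := p.mapQ p f hp
  have map_le (b : K) : (f.eigenspace b).map p.mkQ ≤ fQ.eigenspace b := by
    rintro _ ⟨y, hy, rfl⟩
    rw [mem_eigenspace_iff, Submodule.mkQ_apply, Submodule.mapQ_apply, mem_eigenspace_iff.1 hy,
      Submodule.Quotient.mk_smul]
  have hw' : p.mkQ w ∈ ⨆ (b) (_ : b ≠ a), fQ.eigenspace b := by
    have := Submodule.mem_map_of_mem (f := p.mkQ) hw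
    simp only [Submodule.map_iSup] at this
    exact iSup₂_mono (fun b _ => map_le b) this
  have huw : p.mkQ u = -p.mkQ w := by
    rw [eq_neg_iff_add_eq_zero, ← map_add, Submodule.mkQ_apply, Submodule.Quotient.mk_eq_zero]
    exact h
  have hu0 : p.mkQ u = 0 := Submodule.disjoint_def.1 (eigenspaces_iSupIndep fQ a) _
    (map_le a (Submodule.mem_map_of_mem hu)) (huw ▸ neg_mem hw')
  exact (Submodule.Quotient.mk_eq_zero p).1 hu0

variable {σ κ : Type*}

lemma mem_of_sum_mem_of_mem_iInf_eigenspace {f : σ → Module.End K M} {p : Submodule K M}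
    (hp : ∀ i, p ≤ p.comap (f i)) {χ : κ → σ → K} (hχ : Function.Injective χ) (s : Finset κ)
    (w : κ → M) (hw : ∀ k ∈ s, w k ∈ ⨅ i, (f i).eigenspace (χ k i)) (hs : ∑ k ∈ s, w k ∈ p) :
    ∀ k ∈ s, w k ∈ p := by
  classical
  simp only [Submodule.mem_iInf, mem_eigenspace_iff] at hw
  induction s using Finset.induction_on generalizing w with
  | empty => simp
  | insert a s ha ih =>
    have hmem : ∀ b ∈ s, w b ∈ p := by
      intro b hb
      obtain ⟨i, hi⟩ : ∃ i, χ b i ≠ χ a i :=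
        Function.ne_iff.1 (hχ.ne (ne_of_mem_of_not_mem hb ha))
      have apply_sub : f i (∑ k ∈ insert a s, w k) - χ a i • ∑ k ∈ insert a s, w k =
          ∑ k ∈ s, (χ k i - χ a i) • w k := by
        rw [map_sum, Finset.smul_sum, ← Finset.sum_sub_distrib, Finset.sum_insert ha,
          hw a (Finset.mem_insert_self a s), sub_self, zero_add]
        exact Finset.sum_congr rfl fun k hk => by
          rw [hw k (Finset.mem_insert_of_mem hk), sub_smul]
      have sum_mem : ∑ k ∈ s, (χ k i - χ a i) • w k ∈ p :=
        apply_sub ▸ p.sub_mem (hp i hs) (p.smul_mem _ hs)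
      have smul_mem := ih (fun k => (χ k i - χ a i) • w k) sum_mem
        (fun k hk j => by rw [map_smul, hw k (Finset.mem_insert_of_mem hk), smul_comm]) b hb
      exact (p.smul_mem_iff (sub_ne_zero.2 hi)).1 smul_mem
    intro k hk
    rcases Finset.mem_insert.1 hk with rfl | hk
    · rw [Finset.sum_insert ha] at hs
      exact (p.add_mem_iff_left (p.sum_mem hmem)).1 hs
    · exact hmem k hk

lemma iSupIndep_iInf_eigenspace (f : σ → Module.End K M) {χ : κ → σ → K}
    (hχ : Function.Injective χ) : iSupIndep fun k => ⨅ i, (f i).eigenspace (χ k i) := by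
  rw [iSupIndep_iff_finsetSum_eq_zero_imp_eq_zero]
  intro s w hw h0 k hk
  exact (Submodule.mem_bot K).1 (mem_of_sum_mem_of_mem_iInf_eigenspace (p := ⊥)
    (fun _ => bot_le) hχ s w hw ((Submodule.mem_bot K).2 h0) k hk)

end Eigen

/-! ### Weights below the highest weight -/

section LowerWeights

variable {K L M : Type*} [Field K] [LieRing L] [LieAlgebra K L]
  [AddCommGroup M] [Module K M] [LieRingModule L M] [LieModule K L M]

variable (M) in
/-- The sum of the eigenspaces of `x` on `M` for the eigenvalues `a, a - 1, a - 2, …`. For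
`M = L` and `a = -1` this is the part of `L` of negative degree in the grading by `ad x`. -/
def lowerWeights (x : L) (a : K) : Submodule K M :=
  ⨆ j : ℕ, (LieModule.toEnd K L M x).eigenspace (a - j)

lemma mem_lowerWeights {x : L} {a : K} {w : M} (j : ℕ) (hw : ⁅x, w⁆ = (a - j) • w) :
    w ∈ lowerWeights M x a :=
  Submodule.mem_iSup_of_mem j (Module.End.mem_eigenspace_iff.2 hw)

lemma lowerWeights_le {x : L} {a : K} {p : Submodule K M}
    (h : ∀ (j : ℕ) (w : M), ⁅x, w⁆ = (a - j) • w → w ∈ p) : lowerWeights M x a ≤ p :=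
  iSup_le fun j w hw => h j w (Module.End.mem_eigenspace_iff.1 hw)

lemma lie_mem_lowerWeights {x : L} {a b : K} {y : L} {w : M} (hy : y ∈ lowerWeights L x a)
    (hw : w ∈ lowerWeights M x b) : ⁅y, w⁆ ∈ lowerWeights M x (a + b) := by
  suffices lowerWeights L x a ≤ (lowerWeights M x (a + b)).comap
      ((LieModule.toEnd K L M : L →ₗ[K] M →ₗ[K] M).flip w) from this hy
  refine lowerWeights_le fun i y hy => ?_
  suffices lowerWeights M x b ≤
      (lowerWeights M x (a + b)).comap (LieModule.toEnd K L M y) from this hw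
  refine lowerWeights_le fun j w hw => mem_lowerWeights (i + j) ?_
  rw [LieModule.toEnd_apply_apply, leibniz_lie, hy, hw, smul_lie, lie_smul, ← add_smul]
  congr 1
  push_cast
  ring

lemma lowerWeights_sub_one_le (x : L) (a : K) : lowerWeights M x (a - 1) ≤ lowerWeights M x a :=
  lowerWeights_le fun j w hw => mem_lowerWeights (j + 1) <| by
    rw [hw, Nat.cast_add, Nat.cast_one, sub_add_eq_sub_sub_swap]

lemma lowerWeights_sub_one_le_iSup_ne [CharZero K] (x : L) (a : K) :
    lowerWeights M x (a - 1) ≤ ⨆ (b) (_ : b ≠ a), (LieModule.toEnd K L M x).eigenspace b := by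
  refine iSup_le fun j => le_iSup₂_of_le (a - 1 - j) (fun h => ?_) le_rfl
  exact Nat.cast_add_one_ne_zero (R := K) j (by linear_combination -h)

variable (K) in
/-- The subalgebra of elements of degree `-1, -2, …` for the grading of `L` by the eigenvalues
of `ad x`. -/
def negativePart (x : L) : LieSubalgebra K L :=
  { lowerWeights L x (-1 : K) with
    lie_mem' := fun {y z} hy hz => by
      have := lie_mem_lowerWeights hy hz
      rw [← sub_eq_add_neg] at this
      exact lowerWeights_sub_one_le x _ this }

lemma lie_mem_lowerWeights_sub_one {x : L} {a : K} {y : L} {w : M} (hy : y ∈ negativePart K x)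
    (hw : w ∈ lowerWeights M x a) : ⁅y, w⁆ ∈ lowerWeights M x (a - 1) := by
  rw [sub_eq_neg_add]
  exact lie_mem_lowerWeights hy hw

lemma mem_of_add_lowerWeights_mem [CharZero K] {x : L} {a : K} {p : Submodule K M}
    (hp : ∀ w ∈ p, ⁅x, w⁆ ∈ p) {u w : M} (hu : ⁅x, u⁆ = a • u)
    (hw : w ∈ lowerWeights M x (a - 1)) (h : u + w ∈ p) : u ∈ p :=
  mem_of_add_iSup_eigenspace_mem (f := LieModule.toEnd K L M x) hp
    (Module.End.mem_eigenspace_iff.2 hu) (lowerWeights_sub_one_le_iSup_ne x a hw) h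

end LowerWeights

/-! ### Modules generated by a highest weight vector -/

section HighestWeight

section Stabilizer

variable {R L M : Type*} [CommRing R] [LieRing L] [LieAlgebra R L]
  [AddCommGroup M] [Module R M] [LieRingModule L M] [LieModule R L M]

variable (L) in
/-- The Lie subalgebra of the elements mapping the subspace `p` into itself. The elements having
`u` as an eigenvector form the stabilizer of the line through `u`. -/
def stabilizer (p : Submodule R M) : LieSubalgebra R L where
  carrier := {y | ∀ w ∈ p, ⁅y, w⁆ ∈ p}
  add_mem' hy hz w hw := by rw [add_lie]; exact add_mem (hy w hw) (hz w hw)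
  zero_mem' w _ := by rw [zero_lie]; exact zero_mem p
  smul_mem' c y hy w hw := by rw [smul_lie]; exact p.smul_mem c (hy w hw)
  lie_mem' hy hz w hw := by
    rw [lie_lie]
    exact sub_mem (hy _ (hz w hw)) (hz _ (hy w hw))

lemma mem_stabilizer {p : Submodule R M} {y : L} :
    y ∈ stabilizer L p ↔ ∀ w ∈ p, ⁅y, w⁆ ∈ p := Iff.rfl

lemma mem_stabilizer_span_singleton {y : L} {u : M} {c : R} (h : ⁅y, u⁆ = c • u) :
    y ∈ stabilizer L (R ∙ u) := by
  intro w hw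
  obtain ⟨b, rfl⟩ := Submodule.mem_span_singleton.1 hw
  rw [lie_smul, h]
  exact Submodule.smul_mem _ b (Submodule.smul_mem _ c (Submodule.mem_span_singleton_self u))

lemma eq_top_of_lie_mem {N : Submodule R L} {u : M}
    (hL : N ⊔ (stabilizer L (R ∙ u)).toSubmodule = ⊤) (hM : LieSubmodule.lieSpan R L {u} = ⊤)
    {W : Submodule R M} (hu : u ∈ W) (hW : ∀ y ∈ N, ∀ w ∈ W, ⁅y, w⁆ ∈ W) : W = ⊤ := by
  -- The smallest subspace `P` containing `u` and stable under `N` is stable under all of `L`: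
  -- the vectors that `L` maps into `P` form another such subspace.
  let P : Submodule R M := sInf {W | u ∈ W ∧ ∀ y ∈ N, ∀ w ∈ W, ⁅y, w⁆ ∈ W}
  have P_le {W : Submodule R M} (hu : u ∈ W) (hW : ∀ y ∈ N, ∀ w ∈ W, ⁅y, w⁆ ∈ W) : P ≤ W :=
    sInf_le ⟨hu, hW⟩
  have u_mem : u ∈ P := Submodule.mem_sInf.2 fun W hW => hW.1
  have lie_mem : ∀ y ∈ N, ∀ w ∈ P, ⁅y, w⁆ ∈ P := fun y hy w hw =>
    Submodule.mem_sInf.2 fun W hW => hW.2 y hy w (P_le hW.1 hW.2 hw)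
  let Q : Submodule R M := ⨅ z : L, P.comap (LieModule.toEnd R L M z)
  have mem_Q {w : M} : w ∈ Q ↔ ∀ z : L, ⁅z, w⁆ ∈ P := Submodule.mem_iInf _
  have P_le_Q : P ≤ Q := by
    refine P_le (mem_Q.2 fun z => ?_) fun y hy w hw => mem_Q.2 fun z => ?_
    · obtain ⟨y, hy, b, hb, rfl⟩ := Submodule.mem_sup.1 (hL ▸ Submodule.mem_top : z ∈ N ⊔ _)
      rw [add_lie]
      exact add_mem (lie_mem y hy u u_mem)
        ((Submodule.span_singleton_le_iff_mem u P).2 u_mem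
          (mem_stabilizer.1 hb u (Submodule.mem_span_singleton_self u)))
    · rw [leibniz_lie]
      exact add_mem (mem_Q.1 hw _) (lie_mem y hy _ (mem_Q.1 hw z))
  let P' : LieSubmodule R L M := { P with lie_mem := fun {z _} hw => mem_Q.1 (P_le_Q hw) z }
  have P'_eq_top : P' = ⊤ :=
    top_le_iff.1 (hM ▸ LieSubmodule.lieSpan_le.2 (Set.singleton_subset_iff.2 u_mem))
  exact top_le_iff.1 (((LieSubmodule.toSubmodule_eq_top P').2 P'_eq_top).ge.trans (P_le hu hW))

end Stabilizer

variable {K L M : Type*} [Field K] [LieRing L] [LieAlgebra K L]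
  [AddCommGroup M] [Module K M] [LieRingModule L M] [LieModule K L M] {x : L} {a : K} {u : M}

lemma span_singleton_sup_lowerWeights_eq_top (hu : ⁅x, u⁆ = a • u)
    (hL : (negativePart K x).toSubmodule ⊔ (stabilizer L (K ∙ u)).toSubmodule = ⊤)
    (hM : LieSubmodule.lieSpan K L {u} = ⊤) : (K ∙ u) ⊔ lowerWeights M x (a - 1) = ⊤ := by
  have le_lowerWeights : (K ∙ u) ⊔ lowerWeights M x (a - 1) ≤ lowerWeights M x a :=
    sup_le ((Submodule.span_singleton_le_iff_mem u _).2 (mem_lowerWeights 0 (by simpa using hu)))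
      (lowerWeights_sub_one_le x a)
  exact eq_top_of_lie_mem hL hM (Submodule.mem_sup_left (Submodule.mem_span_singleton_self u))
    fun y hy w hw => Submodule.mem_sup_right
      (lie_mem_lowerWeights_sub_one hy (le_lowerWeights hw))

lemma mem_span_singleton_of_lie_eq_smul [CharZero K] (hu : ⁅x, u⁆ = a • u)
    (hL : (negativePart K x).toSubmodule ⊔ (stabilizer L (K ∙ u)).toSubmodule = ⊤)
    (hM : LieSubmodule.lieSpan K L {u} = ⊤) {w : M} (hw : ⁅x, w⁆ = a • w) : w ∈ K ∙ u := by
  obtain ⟨v, hv, l, hl, rfl⟩ := Submodule.mem_sup.1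
    ((span_singleton_sup_lowerWeights_eq_top hu hL hM).ge (Submodule.mem_top (x := w)))
  refine mem_of_add_lowerWeights_mem (mem_stabilizer_span_singleton hu) hw (neg_mem hl) ?_
  rwa [add_neg_cancel_right]

end HighestWeight

/-! ### Triangular decompositions -/

section Triangular

variable {R L : Type*} [CommRing R] [LieRing L] [LieAlgebra R L]

open LieSubalgebra

lemma lie_mem_sup_lieSpan {s : Set L} {H : Submodule R L}
    (hH : ∀ h ∈ H, ∀ z ∈ lieSpan R L s, ⁅h, z⁆ ∈ lieSpan R L s) {x : L}
    (hx : ∀ y ∈ s, ⁅x, y⁆ ∈ H ⊔ (lieSpan R L s).toSubmodule) {y : L} (hy : y ∈ lieSpan R L s) :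
    ⁅x, y⁆ ∈ H ⊔ (lieSpan R L s).toSubmodule := by
  have lie_mem_of_mem_sup {w z : L} (hw : w ∈ H ⊔ (lieSpan R L s).toSubmodule)
      (hz : z ∈ lieSpan R L s) : ⁅w, z⁆ ∈ lieSpan R L s := by
    obtain ⟨h, hh, v, hv, rfl⟩ := Submodule.mem_sup.1 hw
    rw [add_lie]
    exact add_mem (hH h hh z hz) (LieSubalgebra.lie_mem _ hv hz)
  induction hy using lieSpan_induction with
  | mem y hy => exact hx y hy
  | zero => rw [lie_zero]; exact zero_mem _
  | add y z _ _ ihy ihz => rw [lie_add]; exact add_mem ihy ihz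
  | smul c y _ ih => rw [lie_smul]; exact Submodule.smul_mem _ c ih
  | lie y z hy hz ihy ihz =>
    rw [leibniz_lie, ← lie_skew y]
    exact Submodule.mem_sup_right (add_mem (lie_mem_of_mem_sup ihy hz)
      (neg_mem (lie_mem_of_mem_sup ihz hy)))

lemma lie_mem_lieSpan {s : Set L} {h : L} (hs : ∀ y ∈ s, ⁅h, y⁆ ∈ lieSpan R L s) {y : L}
    (hy : y ∈ lieSpan R L s) : ⁅h, y⁆ ∈ lieSpan R L s := by
  have := lie_mem_sup_lieSpan (H := ⊥) (x := h)
    (fun x hx z _ => by rw [(Submodule.mem_bot R).1 hx, zero_lie]; exact zero_mem _)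
    (fun y hy => Submodule.mem_sup_right (hs y hy)) hy
  rwa [bot_sup_eq] at this

variable {s t : Set L} {H : Submodule R L}

lemma subset_stabilizer_lieSpan_sup_sup_lieSpan
    (hs : ∀ h ∈ H, ∀ y ∈ s, ⁅h, y⁆ ∈ lieSpan R L s) (ht : ∀ h ∈ H, ∀ y ∈ t, ⁅h, y⁆ ∈ lieSpan R L t)
    (hst : ∀ x ∈ s, ∀ y ∈ t, ⁅x, y⁆ ∈ H) :
    s ⊆ stabilizer L ((lieSpan R L s).toSubmodule ⊔ H ⊔ (lieSpan R L t).toSubmodule) := by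
  intro x hx w hw
  have hx' : x ∈ lieSpan R L s := subset_lieSpan hx
  obtain ⟨_, hyh, z, hz, rfl⟩ := Submodule.mem_sup.1 hw
  obtain ⟨y, hy, h, hh, rfl⟩ := Submodule.mem_sup.1 hyh
  rw [lie_add, lie_add]
  refine add_mem (Submodule.mem_sup_left (Submodule.mem_sup_left (add_mem ?_ ?_))) ?_
  · exact LieSubalgebra.lie_mem _ hx' hy
  · rw [← lie_skew]
    exact neg_mem (hs h hh x hx)
  · refine (sup_le_sup_right le_sup_right _ : H ⊔ (lieSpan R L t).toSubmodule ≤ _) ?_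
    exact lie_mem_sup_lieSpan (fun h hh _ => lie_mem_lieSpan (ht h hh))
      (fun y hy => Submodule.mem_sup_left (hst x hx y hy)) hz

lemma lieSpan_sup_sup_lieSpan_eq_top (hH : ∀ h ∈ H, ∀ h' ∈ H, ⁅h, h'⁆ ∈ H)
    (hs : ∀ h ∈ H, ∀ y ∈ s, ⁅h, y⁆ ∈ lieSpan R L s) (ht : ∀ h ∈ H, ∀ y ∈ t, ⁅h, y⁆ ∈ lieSpan R L t)
    (hst : ∀ x ∈ s, ∀ y ∈ t, ⁅x, y⁆ ∈ H) (hgen : lieSpan R L (s ∪ H ∪ t) = ⊤) :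
    (lieSpan R L s).toSubmodule ⊔ H ⊔ (lieSpan R L t).toSubmodule = ⊤ := by
  set T := (lieSpan R L s).toSubmodule ⊔ H ⊔ (lieSpan R L t).toSubmodule with hT
  have s_subset : s ⊆ stabilizer L T := subset_stabilizer_lieSpan_sup_sup_lieSpan hs ht hst
  have t_subset : t ⊆ stabilizer L T := by
    have hts : ∀ y ∈ t, ∀ x ∈ s, ⁅y, x⁆ ∈ H := fun y hy x hx => by
      rw [← lie_skew]
      exact neg_mem (hst x hx y hy)
    rw [hT, sup_comm _ (lieSpan R L t).toSubmodule, sup_comm _ H, ← sup_assoc]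
    exact subset_stabilizer_lieSpan_sup_sup_lieSpan ht hs hts
  have H_subset : (H : Set L) ⊆ stabilizer L T := fun h hh => by
    suffices T ≤ T.comap (LieModule.toEnd R L L h) from this
    refine sup_le (sup_le ?_ ?_) ?_
    · exact fun y hy =>
        Submodule.mem_sup_left (Submodule.mem_sup_left (lie_mem_lieSpan (hs h hh) hy))
    · exact fun y hy => Submodule.mem_sup_left (Submodule.mem_sup_right (hH h hh y hy))
    · exact fun y hy => Submodule.mem_sup_right (lie_mem_lieSpan (ht h hh) hy)
  have mem_stabilizer (y : L) : y ∈ stabilizer L T := by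
    have : lieSpan R L (s ∪ H ∪ t) ≤ stabilizer L T :=
      lieSpan_le.2 (Set.union_subset (Set.union_subset s_subset H_subset) t_subset)
    exact this (hgen ▸ LieSubalgebra.mem_top y)
  let T' : LieSubalgebra R L := { T with lie_mem' := fun {y z} _ hz => mem_stabilizer y z hz }
  have le_T' : lieSpan R L (s ∪ H ∪ t) ≤ T' := lieSpan_le.2 <| Set.union_subset
    (Set.union_subset
      (fun x hx => Submodule.mem_sup_left (Submodule.mem_sup_left (subset_lieSpan hx)))
      fun h hh => Submodule.mem_sup_left (Submodule.mem_sup_right hh))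
    fun y hy => Submodule.mem_sup_right (subset_lieSpan hy)
  exact (LieSubalgebra.toSubmodule_eq_top T').2 (top_le_iff.1 (hgen ▸ le_T'))

end Triangular

/-! ### Kac-Moody algebras -/

section TriangularGrading

variable {𝔤 : Type*} [LieRing 𝔤] [LieAlgebra ℂ 𝔤]

/-- The triangular decomposition `𝔤 = N⁻ + 𝔥 + N` with `N ⊆ 𝔤'`, in the weak form used for highest
weight modules: all that is kept of `N⁻` is that it lies in the negative part of the grading of `𝔤`
by the eigenvalues of `ad x`, where `x ∈ 𝔥`. -/
structure IsTriangularGrading (H N : Submodule ℂ 𝔤) (x : 𝔤) : Prop where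
  mem : x ∈ H
  le_derived : N ≤ (derived 𝔤).toSubmodule
  sup_eq_top : (negativePart ℂ x).toSubmodule ⊔ H ⊔ N = ⊤

lemma lie_mem_derived (x y : 𝔤) : ⁅x, y⁆ ∈ derived 𝔤 :=
  LieSubmodule.lie_mem_lie (LieSubmodule.mem_top x) (LieSubmodule.mem_top y)

lemma mem_derived_of_lie_eq_smul {x y : 𝔤} {c : ℂ} (hc : c ≠ 0) (h : ⁅x, y⁆ = c • y) :
    y ∈ derived 𝔤 := by
  have := (derived 𝔤).smul_mem c⁻¹ (lie_mem_derived x y)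
  rwa [h, smul_smul, inv_mul_cancel₀ hc, one_smul] at this

end TriangularGrading

lemma Realization.exists_root_eq_one {ι : Type*} [Fintype ι] {C : Matrix ι ι ℤ} {𝔥 : Type*}
    [AddCommGroup 𝔥] [Module ℂ 𝔥] (ρ : Realization C 𝔥) : ∃ x : 𝔥, ∀ i, ρ.root i x = 1 := by
  have := ρ.finite
  obtain ⟨φ, hφ⟩ := LinearMap.exists_extend
    ((Module.Basis.span ρ.root_indep).constr ℂ fun _ => (1 : ℂ))
  refine ⟨(Module.evalEquiv ℂ 𝔥).symm φ, fun i => ?_⟩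
  rw [Module.apply_evalEquiv_symm_apply]
  have h := LinearMap.congr_fun hφ (Module.Basis.span ρ.root_indep i)
  rwa [Module.Basis.constr_basis, LinearMap.comp_apply, Submodule.subtype_apply,
    Module.Basis.span_apply] at h

section KacMoody

namespace KM

variable {ι : Type*} [Fintype ι] [DecidableEq ι] {C : Matrix ι ι ℤ}
  {𝔥 : Type*} [AddCommGroup 𝔥] [Module ℂ 𝔥] (ρ : Realization C 𝔥)

/-- The quotient map from the free Lie algebra, as a homomorphism. -/
def mkHom : FreeLieAlgebra ℂ (Gen ι 𝔥) →ₗ⁅ℂ⁆ KM ρ where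
  toFun := KM.mk ρ
  map_add' _ _ := rfl
  map_smul' _ _ := rfl
  map_lie' := rfl

lemma mkHom_surjective : Function.Surjective (mkHom ρ) := fun y => by
  obtain ⟨y, rfl⟩ := LieSubmodule.Quotient.surjective_mk' _ y
  obtain ⟨z, rfl⟩ := LieSubmodule.Quotient.surjective_mk' _ y
  exact ⟨z, rfl⟩

lemma mkHom_eq_zero {x : FreeLieAlgebra ℂ (Gen ι 𝔥)} (hx : Rels ρ x) : mkHom ρ x = 0 := by
  have h : PreKM.mk ρ x = 0 :=
    (LieSubmodule.Quotient.mk_eq_zero _).2 (LieSubmodule.subset_lieSpan hx)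
  change LieSubmodule.Quotient.mk (PreKM.mk ρ x) = _
  rw [h]
  rfl

/-- The generator `e_i` of the Kac-Moody algebra. -/
def e (i : ι) : KM ρ := KM.mk ρ (FreeLieAlgebra.of ℂ (Gen.e i))

/-- The generator `f_i` of the Kac-Moody algebra. -/
def f (i : ι) : KM ρ := KM.mk ρ (FreeLieAlgebra.of ℂ (Gen.f i))

/-- The map from `𝔥` to the Kac-Moody algebra. -/
def h : 𝔥 →ₗ[ℂ] KM ρ where
  toFun x := KM.mk ρ (FreeLieAlgebra.of ℂ (Gen.h x))
  map_add' x y := sub_eq_zero.1 (mkHom_eq_zero ρ (.add x y))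
  map_smul' c x := sub_eq_zero.1 (mkHom_eq_zero ρ (.smul c x))

lemma cartan_eq_range : cartan ρ = (h ρ).range := by
  rw [← Submodule.span_eq (h ρ).range, LinearMap.coe_range]
  rfl

lemma h_lie_h (x y : 𝔥) : ⁅h ρ x, h ρ y⁆ = 0 := mkHom_eq_zero ρ (.hh x y)

lemma h_lie_e (x : 𝔥) (i : ι) : ⁅h ρ x, e ρ i⁆ = ρ.root i x • e ρ i :=
  sub_eq_zero.1 (mkHom_eq_zero ρ (.he x i))

lemma h_lie_f (x : 𝔥) (i : ι) : ⁅h ρ x, f ρ i⁆ = -ρ.root i x • f ρ i := by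
  rw [neg_smul]
  exact eq_neg_of_add_eq_zero_left (mkHom_eq_zero ρ (.hf x i))

lemma e_lie_f (i j : ι) : ⁅e ρ i, f ρ j⁆ = if i = j then h ρ (ρ.coroot i) else 0 := by
  have h := mkHom_eq_zero ρ (.ef i j)
  rw [map_sub, sub_eq_zero] at h
  refine Eq.trans h ?_
  split_ifs
  · rfl
  · exact map_zero _

open LieSubalgebra in
lemma lieSpan_generators_eq_top :
    lieSpan ℂ (KM ρ) (Set.range (f ρ) ∪ cartan ρ ∪ Set.range (e ρ)) = ⊤ := by
  set K := lieSpan ℂ (KM ρ) (Set.range (f ρ) ∪ cartan ρ ∪ Set.range (e ρ))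
  let g : Gen ι 𝔥 → K := fun
    | .e i => ⟨e ρ i, subset_lieSpan (.inr ⟨i, rfl⟩)⟩
    | .f i => ⟨f ρ i, subset_lieSpan (.inl (.inl ⟨i, rfl⟩))⟩
    | .h x => ⟨h ρ x, subset_lieSpan (.inl (.inr (Submodule.subset_span ⟨x, rfl⟩)))⟩
  have hg : K.incl.comp (FreeLieAlgebra.lift ℂ g) = mkHom ρ := by
    refine FreeLieAlgebra.hom_ext fun a => ?_
    rw [LieHom.comp_apply, FreeLieAlgebra.lift_of_apply]
    cases a <;> rfl
  refine eq_top_iff.2 fun y _ => ?_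
  obtain ⟨z, rfl⟩ := mkHom_surjective ρ y
  rw [← hg]
  exact (FreeLieAlgebra.lift ℂ g z).2

open LieSubalgebra in
lemma lieSpan_f_sup_cartan_sup_pos_eq_top :
    (lieSpan ℂ (KM ρ) (Set.range (f ρ))).toSubmodule ⊔ cartan ρ ⊔ pos ρ = ⊤ := by
  refine lieSpan_sup_sup_lieSpan_eq_top (t := Set.range (e ρ)) ?_ ?_ ?_ ?_
    (lieSpan_generators_eq_top ρ)
  all_goals simp only [cartan_eq_range, LinearMap.mem_range, forall_exists_index,
    forall_apply_eq_imp_iff, Set.forall_mem_range]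
  · exact fun x y => ⟨0, by rw [h_lie_h, map_zero]⟩
  · exact fun x i => by
      rw [h_lie_f]
      exact LieSubalgebra.smul_mem _ _ (subset_lieSpan ⟨i, rfl⟩)
  · exact fun x i => by
      rw [h_lie_e]
      exact LieSubalgebra.smul_mem _ _ (subset_lieSpan ⟨i, rfl⟩)
  · intro i j
    rw [← lie_skew, e_lie_f]
    split_ifs
    · exact ⟨-ρ.coroot j, map_neg _ _⟩
    · exact ⟨0, by rw [map_zero, neg_zero]⟩

lemma pos_le_derived : pos ρ ≤ (derived (KM ρ)).toSubmodule := by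
  obtain ⟨x, hx⟩ := ρ.exists_root_eq_one
  suffices LieSubalgebra.lieSpan ℂ (KM ρ) (Set.range (e ρ)) ≤
      LieIdeal.toLieSubalgebra ℂ (KM ρ) (derived (KM ρ)) from this
  rw [LieSubalgebra.lieSpan_le]
  rintro _ ⟨i, rfl⟩
  exact mem_derived_of_lie_eq_smul (by rw [hx]; exact one_ne_zero) (h_lie_e ρ x i)

lemma exists_isTriangularGrading : ∃ x, IsTriangularGrading (cartan ρ) (pos ρ) x := by
  obtain ⟨x, hx⟩ := ρ.exists_root_eq_one
  have lieSpan_f_le :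
      LieSubalgebra.lieSpan ℂ (KM ρ) (Set.range (f ρ)) ≤ negativePart ℂ (h ρ x) := by
    rw [LieSubalgebra.lieSpan_le]
    rintro _ ⟨i, rfl⟩
    exact mem_lowerWeights 0 (by rw [h_lie_f, hx, Nat.cast_zero, sub_zero])
  refine ⟨h ρ x, Submodule.subset_span ⟨x, rfl⟩, pos_le_derived ρ, top_le_iff.1 ?_⟩
  rw [← lieSpan_f_sup_cartan_sup_pos_eq_top]
  exact sup_le_sup_right
    (sup_le_sup_right ((LieSubalgebra.toSubmodule_le_toSubmodule _ _).2 lieSpan_f_le) _) _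

end KM

end KacMoody

/-! ### Triangular decomposition of the loop algebra -/

section LoopTriangular

variable {𝔤 : Type*} [LieRing 𝔤] [LieAlgebra ℂ 𝔤] {H N : Submodule ℂ 𝔤} {n : ℕ} {x : 𝔤}

lemma lowerWeights_neg_one_le_derived (x : 𝔤) :
    lowerWeights 𝔤 x (-1 : ℂ) ≤ (derived 𝔤).toSubmodule :=
  lowerWeights_le fun j _ hy => mem_derived_of_lie_eq_smul
    (by rw [← neg_add']; exact neg_ne_zero.2 (add_comm (j : ℂ) 1 ▸ Nat.cast_add_one_ne_zero j)) hy

lemma IsTriangularGrading.derived_eq (hx : IsTriangularGrading H N x) :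
    (derived 𝔤).toSubmodule =
      lowerWeights 𝔤 x (-1 : ℂ) ⊔ N ⊔ H ⊓ (derived 𝔤).toSubmodule := by
  have top_eq : lowerWeights 𝔤 x (-1 : ℂ) ⊔ N ⊔ H = ⊤ := by
    rw [sup_right_comm]
    exact hx.sup_eq_top
  rw [← sup_inf_assoc_of_le H (sup_le (lowerWeights_neg_one_le_derived x) hx.le_derived), top_eq,
    top_inf_eq]

/-- The element `x ⊗ 1` of `𝔥_A`. -/
def constCartan (n : ℕ) (hx : x ∈ H) : cartanLoop H n :=
  have : (1 : Laurent n) ⊗ₜ[ℂ] x ∈ constSub n H := Submodule.mem_map_of_mem hx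
  ⟨⟨1 ⊗ₜ x, Submodule.mem_sup_right this⟩, Submodule.mem_sup_right this⟩

lemma isHomog_constCartan (hx : x ∈ H) : IsHomog 0 (constCartan n hx : loopAlg H n) :=
  ⟨x, rfl⟩

lemma tmul_mem_map_negativePart (hx : x ∈ H) (p : Laurent n) {y : 𝔤}
    (hy : y ∈ lowerWeights 𝔤 x (-1 : ℂ)) :
    p ⊗ₜ[ℂ] y ∈ (negativePart ℂ (constCartan n hx : loopAlg H n)).toSubmodule.map
      (loopAlg H n).toSubmodule.subtype := by
  suffices lowerWeights 𝔤 x (-1 : ℂ) ≤ Submodule.comap (TensorProduct.mk ℂ (Laurent n) 𝔤 p)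
      ((negativePart ℂ (constCartan n hx : loopAlg H n)).toSubmodule.map
        (loopAlg H n).toSubmodule.subtype) from this hy
  refine lowerWeights_le fun j y hy => ?_
  have hy' : y ∈ (derived 𝔤).toSubmodule :=
    lowerWeights_neg_one_le_derived x (mem_lowerWeights j hy)
  refine ⟨⟨p ⊗ₜ y, Submodule.mem_sup_left (tmul_mem_loopSub p hy')⟩,
    mem_lowerWeights j (Subtype.ext ?_), rfl⟩
  change ⁅(1 : Laurent n) ⊗ₜ x, p ⊗ₜ y⁆ = (-1 - j : ℂ) • (p ⊗ₜ y)
  rw [loop_lie_tmul, hy, one_mul, TensorProduct.tmul_smul]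

lemma IsTriangularGrading.loop_sup_eq_top (hx : IsTriangularGrading H N x) (n : ℕ) :
    (negativePart ℂ (constCartan n hx.mem : loopAlg H n)).toSubmodule ⊔ cartanLoop H n ⊔
      posLoop H n N = ⊤ := by
  set S := (negativePart ℂ (constCartan n hx.mem : loopAlg H n)).toSubmodule ⊔ cartanLoop H n ⊔
    posLoop H n N
  set T := S.map (loopAlg H n).toSubmodule.subtype
  have const_le : constSub n H ≤ T := fun z hz =>
    ⟨⟨z, Submodule.mem_sup_right hz⟩,
      Submodule.mem_sup_left (Submodule.mem_sup_right (Submodule.mem_sup_right hz)), rfl⟩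
  have derived_le (p : Laurent n) :
      (derived 𝔤).toSubmodule ≤ T.comap (TensorProduct.mk ℂ (Laurent n) 𝔤 p) := by
    conv_lhs => rw [hx.derived_eq]
    refine sup_le (sup_le (fun y hy => ?_) fun y hy => ?_) fun y hy => ?_
    · exact Submodule.map_mono (le_sup_left.trans le_sup_left)
        (tmul_mem_map_negativePart hx.mem p hy)
    · exact ⟨⟨p ⊗ₜ y, Submodule.mem_sup_left (tmul_mem_loopSub p (hx.le_derived hy))⟩,
        Submodule.mem_sup_right (tmul_mem_loopSub p hy), rfl⟩
    · exact ⟨⟨p ⊗ₜ y, Submodule.mem_sup_left (tmul_mem_loopSub p hy.2)⟩, Submodule.mem_sup_left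
        (Submodule.mem_sup_right (Submodule.mem_sup_left (tmul_mem_loopSub p hy))), rfl⟩
  have loop_le : loopSub n (derived 𝔤).toSubmodule ≤ T := by
    refine Submodule.span_le.2 ?_
    rintro _ ⟨p, y, hy, rfl⟩
    exact derived_le p hy
  refine eq_top_iff.2 fun y _ => ?_
  obtain ⟨z, hz, hzy⟩ := sup_le loop_le const_le y.2
  rwa [← Subtype.ext hzy]

end LoopTriangular

/-! ### The module `V(ψ)` -/

section HW

attribute [local instance] LieRing.ofAssociativeRing

lemma adjoin_range_universalEnvelopingAlgebra_ι (R L : Type*) [CommRing R] [LieRing L]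
    [LieAlgebra R L] :
    Algebra.adjoin R (Set.range (UniversalEnvelopingAlgebra.ι R (L := L))) = ⊤ := by
  set B := Algebra.adjoin R (Set.range (UniversalEnvelopingAlgebra.ι R (L := L)))
  let j : L →ₗ⁅R⁆ B :=
    { toFun := fun x => ⟨UniversalEnvelopingAlgebra.ι R x, Algebra.subset_adjoin ⟨x, rfl⟩⟩
      map_add' := fun x y => Subtype.ext (map_add _ x y)
      map_smul' := fun c x => Subtype.ext (map_smul _ c x)
      map_lie' := fun {x y} => Subtype.ext (LieHom.map_lie _ x y) }
  have val_comp_lift : B.val.comp (UniversalEnvelopingAlgebra.lift R j) = AlgHom.id R _ :=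
    UniversalEnvelopingAlgebra.hom_ext R <| LieHom.ext fun x =>
      congrArg B.val (UniversalEnvelopingAlgebra.lift_ι_apply R j x)
  refine Algebra.eq_top_iff.2 fun a => ?_
  rw [← AlgHom.id_apply (R := R) a, ← val_comp_lift]
  exact (UniversalEnvelopingAlgebra.lift R j a).2

variable {𝔤 : Type*} [LieRing 𝔤] [LieAlgebra ℂ 𝔤] {H : Submodule ℂ 𝔤} {n : ℕ}
  {N : Submodule ℂ 𝔤} {ψ : cartanLoop H n →ₗ[ℂ] ℂ}

local notation "U" => UniversalEnvelopingAlgebra ℂ (loopAlg H n)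

namespace HW

lemma smul_mem_lieSubmodule (p : LieSubmodule ℂ (loopAlg H n) (HW N ψ)) (a : U) {w : HW N ψ}
    (hw : w ∈ p) : a • w ∈ p := by
  have ha : a ∈ Algebra.adjoin ℂ (Set.range (UniversalEnvelopingAlgebra.ι ℂ)) :=
    adjoin_range_universalEnvelopingAlgebra_ι ℂ (loopAlg H n) ▸ Algebra.mem_top
  induction ha using Algebra.adjoin_induction generalizing w with
  | mem a ha =>
    obtain ⟨x, rfl⟩ := ha
    exact p.lie_mem hw
  | algebraMap c => rw [algebraMap_smul]; exact p.smul_mem c hw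
  | add a b _ _ iha ihb => rw [add_smul]; exact add_mem (iha hw) (ihb hw)
  | mul a b _ _ iha ihb => rw [mul_smul]; exact iha (ihb hw)

lemma lieSubmodule_eq_top {p : LieSubmodule ℂ (loopAlg H n) (HW N ψ)} {w : HW N ψ} (hw : w ∈ p)
    (hw0 : w ≠ 0) : p = ⊤ := by
  let q : Submodule U (HW N ψ) :=
    { p.toAddSubmonoid with smul_mem' := fun a _ hw => smul_mem_lieSubmodule p a hw }
  let q' : Submodule U (Verma N ψ) := q.comap (vermaRadical N ψ).mkQ
  have q'_eq_top : q' = ⊤ := by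
    by_contra h
    obtain ⟨y, rfl⟩ := Submodule.mkQ_surjective (vermaRadical N ψ) w
    exact hw0 ((Submodule.Quotient.mk_eq_zero _).2
      ((le_sSup h : q' ≤ vermaRadical N ψ) (show y ∈ q' from hw)))
  refine eq_top_iff.2 fun z _ => ?_
  obtain ⟨y, rfl⟩ := Submodule.mkQ_surjective (vermaRadical N ψ) z
  exact (q'_eq_top ▸ Submodule.mem_top : y ∈ q')

lemma eq_top_of_lie_mem {p : Submodule ℂ (HW N ψ)}
    (hp : ∀ (y : loopAlg H n), ∀ w ∈ p, ⁅y, w⁆ ∈ p) {w : HW N ψ} (hw : w ∈ p) (hw0 : w ≠ 0) :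
    p = ⊤ := by
  let q : LieSubmodule ℂ (loopAlg H n) (HW N ψ) := { p with lie_mem := fun {y w} => hp y w }
  exact (LieSubmodule.toSubmodule_eq_top q).2 (lieSubmodule_eq_top hw hw0)

lemma lieSpan_singleton_eq_top {v : HW N ψ} (hv : v ≠ 0) :
    LieSubmodule.lieSpan ℂ (loopAlg H n) {v} = ⊤ :=
  lieSubmodule_eq_top (LieSubmodule.subset_lieSpan rfl) hv

variable (N ψ) in
/-- The image of `1` in `V(ψ)`. -/
def vac : HW N ψ := (vermaRadical N ψ).mkQ ((vermaIdeal N ψ).mkQ 1)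

lemma smul_vac (a : U) : a • vac N ψ = (vermaRadical N ψ).mkQ ((vermaIdeal N ψ).mkQ a) := by
  have : a • vac N ψ = (vermaRadical N ψ).mkQ ((vermaIdeal N ψ).mkQ (a • 1)) := rfl
  rw [this, smul_eq_mul, mul_one]

lemma vac_ne_zero {v : HW N ψ} (hv : v ≠ 0) : vac N ψ ≠ 0 := by
  intro h
  obtain ⟨y, rfl⟩ := Submodule.mkQ_surjective (vermaRadical N ψ) v
  obtain ⟨a, rfl⟩ := Submodule.mkQ_surjective (vermaIdeal N ψ) y
  exact hv (by rw [← smul_vac, h, smul_zero])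

lemma lie_vac (h : cartanLoop H n) : ⁅(h : loopAlg H n), vac N ψ⁆ = ψ h • vac N ψ := by
  rw [lie_def, ← algebraMap_smul U (ψ h), ← sub_eq_zero, ← sub_smul, smul_vac,
    Submodule.mkQ_apply (vermaIdeal N ψ),
    (Submodule.Quotient.mk_eq_zero (vermaIdeal N ψ)).2 (Submodule.subset_span (.inr ⟨h, rfl⟩)),
    map_zero]
  rfl

lemma twistHW_vac {c : Fin n → ℂˣ} (hc : TwistInvariant ψ c) :
    twistHW N ψ hc (vac N ψ) = vac N ψ := by
  have : twistHW N ψ hc (vac N ψ) =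
      (vermaRadical N ψ).mkQ ((vermaIdeal N ψ).mkQ (twistU c 1)) := rfl
  rw [this, map_one]
  rfl

end HW

namespace IsHighestWeightVector

variable {v : HW N ψ} {x : 𝔤}

lemma negativePart_sup_stabilizer_eq_top (hv : IsHighestWeightVector N ψ v)
    (hx : IsTriangularGrading H N x) :
    (negativePart ℂ (constCartan n hx.mem : loopAlg H n)).toSubmodule ⊔
      (stabilizer (loopAlg H n) (ℂ ∙ v)).toSubmodule = ⊤ := by
  rw [← top_le_iff, ← hx.loop_sup_eq_top n, sup_assoc]
  refine sup_le_sup_left (sup_le (fun y hy => ?_) fun y hy => ?_) _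
  · exact mem_stabilizer_span_singleton (hv.cartan ⟨y, hy⟩)
  · exact mem_stabilizer_span_singleton (c := (0 : ℂ)) (by rw [hv.pos y hy, zero_smul])

lemma span_singleton_sup_lowerWeights_eq_top (hv : IsHighestWeightVector N ψ v)
    (hx : IsTriangularGrading H N x) :
    (ℂ ∙ v) ⊔ lowerWeights (HW N ψ) (constCartan n hx.mem : loopAlg H n)
      (ψ (constCartan n hx.mem) - 1) = ⊤ :=
  LoopKM.span_singleton_sup_lowerWeights_eq_top (hv.cartan _)
    (hv.negativePart_sup_stabilizer_eq_top hx) (HW.lieSpan_singleton_eq_top hv.ne_zero)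

lemma twistHW_eq (hv : IsHighestWeightVector N ψ v) (hx : IsTriangularGrading H N x)
    {c : Fin n → ℂˣ} (hc : TwistInvariant ψ c) : twistHW N ψ hc v = v := by
  obtain ⟨a, ha⟩ := Submodule.mem_span_singleton.1 <|
    mem_span_singleton_of_lie_eq_smul (hv.cartan (constCartan n hx.mem))
      (hv.negativePart_sup_stabilizer_eq_top hx) (HW.lieSpan_singleton_eq_top hv.ne_zero)
      (HW.lie_vac _)
  have ha0 : a ≠ 0 := by
    rintro rfl
    exact HW.vac_ne_zero hv.ne_zero (by rw [← ha, zero_smul])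
  have h := HW.twistHW_vac (N := N) hc
  rw [← ha, map_smul] at h
  exact smul_right_injective _ ha0 h

end IsHighestWeightVector

end HW

/-! ### Submodules of `V(ψ) ⊗ A` -/

lemma mono_mem_powSubalgebra {n : ℕ} {r : Fin n → ℕ} {s : Fin n → ℤ}
    (hs : ∀ i, (r i : ℤ) ∣ s i) : mono s ∈ powSubalgebra r := by
  let B : AddSubmonoid (Fin n → ℤ) :=
    { carrier := {s | mono s ∈ powSubalgebra r}
      zero_mem' := one_mem (powSubalgebra r)
      add_mem' := fun {s t} hs ht => by
        change mono (s + t) ∈ powSubalgebra r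
        rw [← mono_mul]
        exact mul_mem hs ht }
  have single_mem (i : Fin n) : Pi.single i (s i) ∈ B := by
    have pos_mem : Pi.single i (r i : ℤ) ∈ B := Algebra.subset_adjoin (.inl ⟨i, rfl⟩)
    have neg_mem : Pi.single i (-(r i : ℤ)) ∈ B := Algebra.subset_adjoin (.inr ⟨i, rfl⟩)
    obtain ⟨c, hc⟩ := hs i
    rcases Int.eq_nat_or_neg c with ⟨m, rfl | rfl⟩
    · rw [hc, mul_comm, ← nsmul_eq_mul, Pi.single_smul]
      exact B.nsmul_mem pos_mem m
    · rw [hc, mul_neg, ← neg_mul, mul_comm, ← nsmul_eq_mul, Pi.single_smul]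
      exact B.nsmul_mem neg_mem m
  rw [← Finset.univ_sum_single s]
  exact B.sum_mem fun i _ => single_mem i

section Submodules

variable {𝔤 : Type*} [LieRing 𝔤] [LieAlgebra ℂ 𝔤] {H N : Submodule ℂ 𝔤} {n : ℕ}
  {ψ : cartanLoop H n →ₗ[ℂ] ℂ} {S : LieSubmodule ℂ (extLoopAlg H n) (HW N ψ ⊗[ℂ] Laurent n)}

lemma loopAct_mem (x : loopAlg H n) {w : HW N ψ ⊗[ℂ] Laurent n} (hw : w ∈ S) :
    loopAct x w ∈ S := by
  have h := S.lie_mem (x := (⟨x, 0⟩ : extLoopAlg H n)) hw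
  rwa [ext_lie_def, map_zero, LinearMap.zero_apply, add_zero] at h

lemma degAct_mem (d : Deg n) {w : HW N ψ ⊗[ℂ] Laurent n} (hw : w ∈ S) : degAct d w ∈ S := by
  have h := S.lie_mem (x := (⟨0, d⟩ : extLoopAlg H n)) hw
  rwa [ext_lie_def, map_zero, LinearMap.zero_apply, zero_add] at h

lemma IsHomog.lie_tmul_mem {m : Fin n → ℤ} {x : loopAlg H n} (hx : IsHomog m x) {w : HW N ψ}
    {p : Laurent n} (h : w ⊗ₜ[ℂ] p ∈ S) : ⁅x, w⁆ ⊗ₜ[ℂ] (mono m * p) ∈ S :=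
  hx.loopAct_tmul w p ▸ loopAct_mem x h

lemma degAct_coord_tmul_mono (i : Fin n) (w : HW N ψ) (m : Fin n → ℤ) :
    degAct (Deg.coord.symm (Pi.single i 1)) (w ⊗ₜ[ℂ] mono m) = (m i : ℂ) • (w ⊗ₜ[ℂ] mono m) := by
  have sum_eq : ∑ j, (Pi.single i 1 : Fin n → ℂ) j * (m j : ℂ) = m i := by
    simp [Pi.single_apply]
  rw [degAct_tmul, LinearEquiv.apply_symm_apply, degDer_mono, sum_eq, TensorProduct.tmul_smul]

/-- The vectors `w` of `V(ψ)` for which `w ⊗ t^m` lies in the submodule `S` of `V(ψ) ⊗ A`. -/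
def slice (S : LieSubmodule ℂ (extLoopAlg H n) (HW N ψ ⊗[ℂ] Laurent n)) (m : Fin n → ℤ) :
    Submodule ℂ (HW N ψ) :=
  S.toSubmodule.comap ((TensorProduct.mk ℂ (HW N ψ) (Laurent n)).flip (mono m))

lemma mem_slice {m : Fin n → ℤ} {w : HW N ψ} : w ∈ slice S m ↔ w ⊗ₜ[ℂ] mono m ∈ S := Iff.rfl

lemma IsHomog.lie_mem_slice {k m : Fin n → ℤ} {x : loopAlg H n} (hx : IsHomog k x) {w : HW N ψ}
    (hw : w ∈ slice S m) : ⁅x, w⁆ ∈ slice S (k + m) := by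
  rw [mem_slice, ← mono_mul]
  exact hx.lie_tmul_mem hw

lemma lie_mem_iInf_slice (x : loopAlg H n) {w : HW N ψ} (hw : w ∈ ⨅ m, slice S m) :
    ⁅x, w⁆ ∈ ⨅ m, slice S m := by
  induction x using homog_induction with
  | h0 => rw [zero_lie]; exact zero_mem _
  | hadd x y hx hy => rw [add_lie]; exact add_mem hx hy
  | hh k x hx =>
    rw [Submodule.mem_iInf] at hw ⊢
    intro m
    simpa only [add_sub_cancel] using hx.lie_mem_slice (hw (m - k))

lemma lie_mem_iSup_slice (x : loopAlg H n) {w : HW N ψ} (hw : w ∈ ⨆ m, slice S m) :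
    ⁅x, w⁆ ∈ ⨆ m, slice S m := by
  induction x using homog_induction with
  | h0 => rw [zero_lie]; exact zero_mem _
  | hadd x y hx hy => rw [add_lie]; exact add_mem hx hy
  | hh k x hx =>
    suffices ⨆ m, slice S m ≤
        (⨆ m, slice S m).comap (LieModule.toEnd ℂ (loopAlg H n) (HW N ψ) x) from this hw
    exact iSup_le fun m w hw => Submodule.mem_iSup_of_mem (k + m) (hx.lie_mem_slice hw)

lemma eq_top_of_mem_iInf_slice {v : HW N ψ} (hv0 : v ≠ 0) (hv : v ∈ ⨅ m, slice S m) : S = ⊤ := by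
  have iInf_eq_top : ⨅ m, slice S m = ⊤ :=
    HW.eq_top_of_lie_mem (fun x _ => lie_mem_iInf_slice x) hv hv0
  have tmul_mono_mem (w : HW N ψ) (m : Fin n → ℤ) : w ⊗ₜ[ℂ] mono m ∈ S :=
    mem_slice.1 (iInf_eq_top.ge.trans (iInf_le _ m) Submodule.mem_top)
  refine eq_top_iff.2 fun z _ => ?_
  obtain ⟨b, rfl⟩ := TensorProduct.eq_repr_basis_right (monoBasis n) z
  exact sum_mem fun m _ => tmul_mono_mem (b m) m

lemma exists_mem_slice_ne_zero (hS : S ≠ ⊥) : ∃ m, ∃ w ∈ slice S m, w ≠ 0 := by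
  obtain ⟨z, hz, hz0⟩ : ∃ z ∈ S, z ≠ 0 := by
    by_contra! h
    exact hS ((LieSubmodule.eq_bot_iff S).2 h)
  obtain ⟨b, rfl⟩ := TensorProduct.eq_repr_basis_right (monoBasis n) z
  have mem_slice_of_mem_support : ∀ m ∈ b.support, b m ∈ slice S m :=
    mem_of_sum_mem_of_mem_iInf_eigenspace
      (f := fun i => degAct (Deg.coord.symm (Pi.single i 1))) (p := S.toSubmodule)
      (χ := fun (m : Fin n → ℤ) i => (m i : ℂ)) (fun i w hw => degAct_mem _ hw)
      (fun m m' h => funext fun i => Int.cast_injective (congrFun h i)) b.support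
      (fun m => b m ⊗ₜ[ℂ] mono m)
      (fun m _ => (Submodule.mem_iInf _).2 fun i =>
        Module.End.mem_eigenspace_iff.2 (degAct_coord_tmul_mono i (b m) m)) hz
  obtain ⟨m, hm⟩ : b.support.Nonempty := by
    rw [Finsupp.support_nonempty_iff]
    rintro rfl
    exact hz0 Finsupp.sum_zero_index
  exact ⟨m, b m, mem_slice_of_mem_support m hm, Finsupp.mem_support_iff.1 hm⟩

lemma iSup_slice_eq_top (hS : S ≠ ⊥) : ⨆ m, slice S m = ⊤ := by
  obtain ⟨m, w, hw, hw0⟩ := exists_mem_slice_ne_zero hS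
  exact HW.eq_top_of_lie_mem (fun x _ => lie_mem_iSup_slice x) (Submodule.mem_iSup_of_mem m hw) hw0

namespace IsHighestWeightVector

variable {v : HW N ψ}

lemma exists_mem_slice {x : 𝔤} (hv : IsHighestWeightVector N ψ v)
    (hx : IsTriangularGrading H N x) (hS : S ≠ ⊥) : ∃ m, v ∈ slice S m := by
  set y := constCartan n hx.mem
  by_contra! hvS
  have slice_le (m : Fin n → ℤ) :
      slice S m ≤ lowerWeights (HW N ψ) (y : loopAlg H n) (ψ y - 1) := by
    intro w hw
    have lie_mem : ∀ u ∈ slice S m, ⁅(y : loopAlg H n), u⁆ ∈ slice S m := fun u hu => by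
      simpa only [zero_add] using (isHomog_constCartan hx.mem).lie_mem_slice hu
    obtain ⟨u, hu, l, hl, rfl⟩ := Submodule.mem_sup.1
      ((hv.span_singleton_sup_lowerWeights_eq_top hx).ge (Submodule.mem_top (x := w)))
    obtain ⟨c, rfl⟩ := Submodule.mem_span_singleton.1 hu
    have smul_mem : c • v ∈ slice S m :=
      mem_of_add_lowerWeights_mem lie_mem (by rw [lie_smul, hv.cartan, smul_comm]) hl hw
    have hc : c = 0 := by
      by_contra hc
      exact hvS m (((slice S m).smul_mem_iff hc).1 smul_mem)
    rwa [hc, zero_smul, zero_add]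
  have hv_low : v ∈ lowerWeights (HW N ψ) (y : loopAlg H n) (ψ y - 1) :=
    iSup_le slice_le ((iSup_slice_eq_top hS).ge Submodule.mem_top)
  have hv_bot : v ∈ (⊥ : Submodule ℂ (HW N ψ)) :=
    mem_of_add_lowerWeights_mem (x := (y : loopAlg H n))
      (fun w hw => by rw [(Submodule.mem_bot ℂ).1 hw, lie_zero]; exact zero_mem _)
      (hv.cartan y) (neg_mem hv_low) (by rw [add_neg_cancel]; exact zero_mem _)
  exact hv.ne_zero ((Submodule.mem_bot ℂ).1 hv_bot)

lemma tmul_mul_mem (hv : IsHighestWeightVector N ψ v) {q : Laurent n} (hq : q ∈ weightAlgebra ψ)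
    {p : Laurent n} (hp : v ⊗ₜ[ℂ] p ∈ S) : v ⊗ₜ[ℂ] (q * p) ∈ S := by
  induction hq using Algebra.adjoin_induction generalizing p with
  | mem q hq =>
    obtain ⟨h, m, rfl⟩ := hq
    have isHomog : IsHomog m (cartanMono h m : loopAlg H n) := ⟨_, rfl⟩
    have lie_tmul_mem := isHomog.lie_tmul_mem hp
    rwa [hv.cartan, TensorProduct.smul_tmul, ← smul_mul_assoc] at lie_tmul_mem
  | algebraMap c =>
    rw [← Algebra.smul_def, TensorProduct.tmul_smul]
    exact S.smul_mem c hp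
  | add q q' _ _ hq hq' =>
    rw [add_mul, TensorProduct.tmul_add]
    exact add_mem (hq hp) (hq' hp)
  | mul q q' _ _ hq hq' =>
    rw [mul_assoc]
    exact hq (hq' hp)

variable {r : Fin n → ℕ}

lemma mem_slice_of_intCast_eq (hv : IsHighestWeightVector N ψ v)
    (hψ : weightAlgebra ψ = powSubalgebra r) {m m' : Fin n → ℤ}
    (hm : ∀ i, (m i : ZMod (r i)) = m' i) (h : v ∈ slice S m) : v ∈ slice S m' := by
  have mono_mem : mono (m' - m) ∈ weightAlgebra ψ := hψ ▸ mono_mem_powSubalgebra fun i =>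
    (ZMod.intCast_eq_intCast_iff_dvd_sub _ _ _).1 (hm i)
  rw [mem_slice, ← sub_add_cancel m' m, ← mono_mul]
  exact hv.tmul_mul_mem mono_mem h

lemma lieSpan_tmul_mono_le (hv : IsHighestWeightVector N ψ v)
    (hψ : weightAlgebra ψ = powSubalgebra r) {m m' : Fin n → ℤ}
    (hm : ∀ i, (m i : ZMod (r i)) = m' i) (h : v ⊗ₜ[ℂ] mono m ∈ S) :
    LieSubmodule.lieSpan ℂ (extLoopAlg H n) {v ⊗ₜ[ℂ] mono m'} ≤ S :=
  LieSubmodule.lieSpan_le.2 (Set.singleton_subset_iff.2 (hv.mem_slice_of_intCast_eq hψ hm h))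

lemma lieSpan_tmul_mono_congr (hv : IsHighestWeightVector N ψ v)
    (hψ : weightAlgebra ψ = powSubalgebra r) {m m' : Fin n → ℤ}
    (hm : ∀ i, (m i : ZMod (r i)) = m' i) :
    LieSubmodule.lieSpan ℂ (extLoopAlg H n) {v ⊗ₜ[ℂ] mono m} =
      LieSubmodule.lieSpan ℂ (extLoopAlg H n) {v ⊗ₜ[ℂ] mono m'} :=
  le_antisymm (hv.lieSpan_tmul_mono_le hψ (fun i => (hm i).symm) (LieSubmodule.subset_lieSpan rfl))
    (hv.lieSpan_tmul_mono_le hψ hm (LieSubmodule.subset_lieSpan rfl))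

lemma iSup_lieSpan_eq_top (hv : IsHighestWeightVector N ψ v)
    (hψ : weightAlgebra ψ = powSubalgebra r) :
    ⨆ k : (i : Fin n) → ZMod (r i), LieSubmodule.lieSpan ℂ (extLoopAlg H n)
      {v ⊗ₜ[ℂ] mono fun i => (k i).cast} = ⊤ := by
  refine eq_top_of_mem_iInf_slice hv.ne_zero ((Submodule.mem_iInf _).2 fun m => ?_)
  rw [mem_slice]
  refine LieSubmodule.mem_iSup_of_mem (fun i => (m i : ZMod (r i))) ?_
  rw [← hv.lieSpan_tmul_mono_congr hψ fun i => (ZMod.intCast_zmod_cast (m i : ZMod (r i))).symm]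
  exact LieSubmodule.subset_lieSpan rfl

end IsHighestWeightVector

lemma tmul_mono_ne_zero {w : HW N ψ} (hw : w ≠ 0) (m : Fin n → ℤ) : w ⊗ₜ[ℂ] mono m ≠ 0 := by
  intro h
  refine hw (Finsupp.single_eq_zero.1 (TensorProduct.sum_tmul_basis_right_eq_zero (monoBasis n)
    (Finsupp.single m w) ?_))
  exact (Finsupp.sum_single_index (h := fun k w => w ⊗ₜ[ℂ] monoBasis n k)
    (TensorProduct.zero_tmul _ _)).trans h

end Submodules

/-! ### The joint eigenspaces -/

lemma isIrreducible_of_isAtom {R L M : Type*} [CommRing R] [LieRing L] [LieAlgebra R L]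
    [AddCommGroup M] [Module R M] [LieRingModule L M] [LieModule R L M] {E : LieSubmodule R L M}
    (hE : IsAtom E) : LieModule.IsIrreducible R L E := by
  have : Nontrivial E := (LieSubmodule.nontrivial_iff_ne_bot R L M).2 hE.1
  have map_injective : Function.Injective (LieSubmodule.map E.incl) :=
    LieSubmodule.map_injective_of_injective Subtype.val_injective
  refine LieModule.IsIrreducible.mk fun T hT => map_injective ?_
  rw [LieSubmodule.map_incl_top]
  refine (hE.le_iff_eq fun h => hT (map_injective ?_)).1 LieSubmodule.map_incl_le
  rw [h, LieSubmodule.map_bot]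

section JointEigenspace

variable {𝔤 : Type*} [LieRing 𝔤] [LieAlgebra ℂ 𝔤] {H N : Submodule ℂ 𝔤} {n : ℕ}
  {ψ : cartanLoop H n →ₗ[ℂ] ℂ} {r : Fin n → ℕ} (hψ : weightAlgebra ψ = powSubalgebra r)
  {ξ : Fin n → ℂˣ} (hξ : ∀ i, IsPrimitiveRoot (ξ i) (r i))

lemma jointEigenspace_toSubmodule (k : (i : Fin n) → ZMod (r i)) :
    (jointEigenspace N hψ hξ k).toSubmodule = ⨅ i, (etaTildeAt N hψ hξ i).eigenspace
      ((ξ i ^ (-((k i).val : ℤ)) : ℂˣ) : ℂ) := rfl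

lemma charPow_inv_mulSingle (i : Fin n) (a : ℂˣ) (m : Fin n → ℤ) :
    charPow (Pi.mulSingle i a)⁻¹ m = ((a ^ (-m i) : ℂˣ) : ℂ) := by
  rw [charPow, Finset.prod_eq_single i]
  · rw [Pi.inv_apply, Pi.mulSingle_eq_same, inv_zpow']
  · intro j _ hj
    rw [Pi.inv_apply, Pi.mulSingle_eq_of_ne hj, inv_one, one_zpow]
  · exact fun h => absurd (Finset.mem_univ i) h

variable [∀ i, NeZero (r i)]

lemma iSupIndep_jointEigenspace : iSupIndep (jointEigenspace N hψ hξ) := by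
  rw [← LieSubmodule.iSupIndep_toSubmodule, funext (jointEigenspace_toSubmodule hψ hξ)]
  refine iSupIndep_iInf_eigenspace (etaTildeAt N hψ hξ)
    (χ := fun (k : (i : Fin n) → ZMod (r i)) i => ((ξ i ^ (-((k i).val : ℤ)) : ℂˣ) : ℂ))
    fun k l hkl => funext fun i => ?_
  have pow_eq := Units.ext (congrFun hkl i)
  rw [zpow_neg, zpow_neg, inv_inj, zpow_natCast, zpow_natCast] at pow_eq
  exact ZMod.val_injective _ ((hξ i).pow_inj (ZMod.val_lt _) (ZMod.val_lt _) pow_eq)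

namespace IsHighestWeightVector

variable {v : HW N ψ} {x : 𝔤}

lemma tmul_mono_mem_jointEigenspace (hv : IsHighestWeightVector N ψ v)
    (hx : IsTriangularGrading H N x) {k : (i : Fin n) → ZMod (r i)} {m : Fin n → ℤ}
    (hm : ∀ i, (m i : ZMod (r i)) = k i) : v ⊗ₜ[ℂ] mono m ∈ jointEigenspace N hψ hξ k := by
  rw [← LieSubmodule.mem_toSubmodule, jointEigenspace_toSubmodule, Submodule.mem_iInf]
  intro i
  have zpow_eq : ξ i ^ (-m i) = ξ i ^ (-((k i).val : ℤ)) := by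
    rw [← div_eq_one, div_eq_mul_inv, ← zpow_sub, (hξ i).zpow_eq_one_iff_dvd,
      ← ZMod.intCast_eq_intCast_iff_dvd_sub]
    push_cast
    rw [ZMod.natCast_zmod_val, hm]
  rw [Module.End.mem_eigenspace_iff, etaTildeAt, etaTilde_tmul, hv.twistHW_eq hx, rescale_mono,
    TensorProduct.tmul_smul, charPow_inv_mulSingle, zpow_eq]

lemma lieSpan_eq_jointEigenspace (hv : IsHighestWeightVector N ψ v)
    (hx : IsTriangularGrading H N x) {k : (i : Fin n) → ZMod (r i)} {m : Fin n → ℤ}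
    (hm : ∀ i, (m i : ZMod (r i)) = k i) :
    LieSubmodule.lieSpan ℂ (extLoopAlg H n) {v ⊗ₜ[ℂ] mono m} = jointEigenspace N hψ hξ k := by
  have lieSpan_le (k : (i : Fin n) → ZMod (r i)) :
      LieSubmodule.lieSpan ℂ (extLoopAlg H n) {v ⊗ₜ[ℂ] mono fun i => (k i).cast} ≤
        jointEigenspace N hψ hξ k :=
    LieSubmodule.lieSpan_le.2 <| Set.singleton_subset_iff.2 <|
      hv.tmul_mono_mem_jointEigenspace hψ hξ hx fun i => ZMod.intCast_zmod_cast (k i)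
  have lieSpan_eq := ((iSupIndep_jointEigenspace hψ hξ).le_iff_eq_of_iSup_eq_top
    (hv.iSup_lieSpan_eq_top hψ)).1 lieSpan_le
  rw [← congrFun lieSpan_eq k]
  exact hv.lieSpan_tmul_mono_congr hψ fun i => by rw [hm, ZMod.intCast_zmod_cast]

lemma iSup_jointEigenspace_eq_top (hv : IsHighestWeightVector N ψ v)
    (hx : IsTriangularGrading H N x) : ⨆ k, jointEigenspace N hψ hξ k = ⊤ := by
  rw [← hv.iSup_lieSpan_eq_top hψ]
  exact iSup_congr fun k =>
    (hv.lieSpan_eq_jointEigenspace hψ hξ hx fun i => ZMod.intCast_zmod_cast (k i)).symm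

lemma isInternal_jointEigenspace (hv : IsHighestWeightVector N ψ v)
    (hx : IsTriangularGrading H N x) :
    DirectSum.IsInternal fun k => (jointEigenspace N hψ hξ k).toSubmodule :=
  DirectSum.isInternal_submodule_iff_iSupIndep_and_iSup_eq_top _ |>.2
    ⟨LieSubmodule.iSupIndep_toSubmodule.2 (iSupIndep_jointEigenspace hψ hξ),
      LieSubmodule.iSup_toSubmodule_eq_top.2 (hv.iSup_jointEigenspace_eq_top hψ hξ hx)⟩

lemma jointEigenspace_ne_bot (hv : IsHighestWeightVector N ψ v)
    (hx : IsTriangularGrading H N x) (k : (i : Fin n) → ZMod (r i)) :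
    jointEigenspace N hψ hξ k ≠ ⊥ := fun h =>
  tmul_mono_ne_zero hv.ne_zero _ <| (LieSubmodule.eq_bot_iff _).1 h _ <|
    hv.tmul_mono_mem_jointEigenspace hψ hξ hx fun i => ZMod.intCast_zmod_cast (k i)

lemma isAtom_jointEigenspace (hv : IsHighestWeightVector N ψ v)
    (hx : IsTriangularGrading H N x) (k : (i : Fin n) → ZMod (r i)) :
    IsAtom (jointEigenspace N hψ hξ k) := by
  refine isAtom_iff_le_of_ge.2 ⟨hv.jointEigenspace_ne_bot hψ hξ hx k, fun S hS hSk => ?_⟩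
  obtain ⟨m, hm⟩ := hv.exists_mem_slice hx hS
  have jointEigenspace_le : jointEigenspace N hψ hξ (fun i => (m i : ZMod (r i))) ≤ S := by
    rw [← hv.lieSpan_eq_jointEigenspace hψ hξ hx fun i => rfl]
    exact LieSubmodule.lieSpan_le.2 (Set.singleton_subset_iff.2 hm)
  have hmk : (fun i => (m i : ZMod (r i))) = k := by
    by_contra hne
    exact hv.jointEigenspace_ne_bot hψ hξ hx _
      (((iSupIndep_jointEigenspace hψ hξ).pairwiseDisjoint hne).eq_bot_of_le
        (jointEigenspace_le.trans hSk))
  rwa [hmk] at jointEigenspace_le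

end IsHighestWeightVector

end JointEigenspace

end LoopKM

end

theorem theorem4p2_general {𝔤 : Type*} [LieRing 𝔤] [LieAlgebra ℂ 𝔤] {H N : Submodule ℂ 𝔤} {x : 𝔤}
    (hx : LoopKM.IsTriangularGrading H N x) (n : ℕ) (ψ : LoopKM.cartanLoop H n →ₗ[ℂ] ℂ)
    (r : Fin n → ℕ) (hr : ∀ i, 0 < r i)
    (hψ : LoopKM.weightAlgebra ψ = LoopKM.powSubalgebra r)
    (ξ : Fin n → ℂˣ) (hξ : ∀ i, IsPrimitiveRoot (ξ i) (r i))
    (v : LoopKM.HW N ψ) (hv : LoopKM.IsHighestWeightVector N ψ v) :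
    (∀ (k : (i : Fin n) → ZMod (r i)) (m : Fin n → ℤ), (∀ i, (m i : ZMod (r i)) = k i) →
      LieSubmodule.lieSpan ℂ (LoopKM.extLoopAlg H n) {v ⊗ₜ[ℂ] LoopKM.mono m} =
        LoopKM.jointEigenspace N hψ hξ k) ∧
    (∀ k, LieModule.IsIrreducible ℂ (LoopKM.extLoopAlg H n)
      (LoopKM.jointEigenspace N hψ hξ k)) ∧
    DirectSum.IsInternal (fun k => (LoopKM.jointEigenspace N hψ hξ k).toSubmodule) := by
  have : ∀ i, NeZero (r i) := fun i => ⟨(hr i).ne'⟩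
  exact ⟨fun k m hm => hv.lieSpan_eq_jointEigenspace hψ hξ hx hm,
    fun k => LoopKM.isIrreducible_of_isAtom (hv.isAtom_jointEigenspace hψ hξ hx k),
    hv.isInternal_jointEigenspace hψ hξ hx⟩

theorem theorem4p2 {ι : Type*} [Fintype ι] [DecidableEq ι] (C : Matrix ι ι ℤ)
    (hC : LoopKM.IsGCM C) {𝔥 : Type*} [AddCommGroup 𝔥] [Module ℂ 𝔥]
    (ρ : LoopKM.Realization C 𝔥) (n : ℕ)
    (ψ : LoopKM.cartanLoop (LoopKM.KM.cartan ρ) n →ₗ[ℂ] ℂ)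
    (r : Fin n → ℕ) (hr : ∀ i, 0 < r i)
    (hψ : LoopKM.weightAlgebra ψ = LoopKM.powSubalgebra r)
    (ξ : Fin n → ℂˣ) (hξ : ∀ i, IsPrimitiveRoot (ξ i) (r i))
    (v : LoopKM.HW (LoopKM.KM.pos ρ) ψ)
    (hv : LoopKM.IsHighestWeightVector (LoopKM.KM.pos ρ) ψ v) :
    (∀ (k : (i : Fin n) → ZMod (r i)) (m : Fin n → ℤ), (∀ i, (m i : ZMod (r i)) = k i) →
      LieSubmodule.lieSpan ℂ (LoopKM.extLoopAlg (LoopKM.KM.cartan ρ) n)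
          {v ⊗ₜ[ℂ] LoopKM.mono m} =
        LoopKM.jointEigenspace (LoopKM.KM.pos ρ) hψ hξ k) ∧
    (∀ k, LieModule.IsIrreducible ℂ (LoopKM.extLoopAlg (LoopKM.KM.cartan ρ) n)
      (LoopKM.jointEigenspace (LoopKM.KM.pos ρ) hψ hξ k)) ∧
    DirectSum.IsInternal
      (fun k => (LoopKM.jointEigenspace (LoopKM.KM.pos ρ) hψ hξ k).toSubmodule) := by
  obtain ⟨x, hx⟩ := LoopKM.KM.exists_isTriangularGrading ρ
  exact theorem4p2_general hx n ψ r hr hψ ξ hξ v hv
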